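/- Cardinals are identified with initial ordinals, $[\lambda]^2$ denotes the set of two-element subsets of $\lambda$, $\theta^+$ is the successor cardinal of $\theta$, and $\chi^{<\theta}=\sup\{\chi^{\kappa} : \kappa<\theta \text{ a cardinal}\}$. For cardinals with $\lambda\ge\mu\ge\sigma+\theta$, let $\mathrm{Pr}_0(\lambda,\mu,\sigma,\theta)$ be the statement that there is a colouring $c:[\lambda]^2\to\sigma$ such that: whenever $\mathbf i_0,\mathbf i_1<\theta$ are ordinals, $\bar\zeta^\iota=\langle\zeta^\iota_{\alpha,i}:\alpha<\mu,\ i<\mathbf i_\iota\rangle$ (for $\iota=0,1$) are sequences without repetitions of ordinals $<\lambda$ whose ranges are disjoint from each other, and $h:\mathbf i_0\times\mathbf i_1\to\sigma$ is any function, there are $\alpha_0<\alpha_1<\mu$ such that $$c\{\zeta^0_{\alpha_0,i_0},\zeta^1_{\alpha_1,i_1}\}=h(i_0,i_1)\qquad\text{for all } i_0<\mathbf i_0,\ i_1<\mathbf i_1 .$$ Theorem. Let $\lambda=\partial^+$, where $\partial$ is a regular cardinal and $\partial>\theta^+\ge\theta\ge\aleph_0$. Assume $\chi=\chi^{<\theta}<\lambda\le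 2^\chi$ and $\chi\le\sigma=\sigma^{<\theta}\le\lambda$. Then $\mathrm{Pr}_0(\lambda,\lambda,\sigma,\theta)$ holds. -/

import Mathlib

open Cardinal Ordinal

universe u

/-- The colouring relation `Pr₀(lam, mu, sig, (th0, th1))` for cardinals
(used when `mu ≤ lam` and `sig + th0 + th1 ≤ mu`).  A cardinal is identified with its initial
ordinal.  A colouring of `[lam]²` is a function `c` on unordered pairs, of which only the values
at pairs of distinct ordinals below `lam` matter; likewise only the values of `ζ0`, `ζ1`, `h` at
the bounded arguments below matter. -/
def Pr0 (lam mu sig th0 th1 : Cardinal.{u}) : Prop :=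
  ∃ c : Sym2 Ordinal.{u} → Ordinal.{u},
    (∀ x y : Ordinal.{u}, x < y → y < lam.ord → c s(x, y) < sig.ord) ∧
    ∀ (i0 i1 : Ordinal.{u}) (ζ0 ζ1 h : Ordinal.{u} → Ordinal.{u} → Ordinal.{u}),
      i0 < th0.ord → i1 < th1.ord →
      -- both families consist of ordinals below `lam`
      (∀ α < mu.ord, ∀ i < i0, ζ0 α i < lam.ord) →
      (∀ α < mu.ord, ∀ i < i1, ζ1 α i < lam.ord) →
      -- each family is without repetitions
      (∀ α < mu.ord, ∀ i < i0, ∀ β < mu.ord, ∀ j < i0, ζ0 α i = ζ0 β j → α = β ∧ i = j) →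
      (∀ α < mu.ord, ∀ i < i1, ∀ β < mu.ord, ∀ j < i1, ζ1 α i = ζ1 β j → α = β ∧ i = j) →
      -- the two ranges are disjoint
      (∀ α < mu.ord, ∀ i < i0, ∀ β < mu.ord, ∀ j < i1, ζ0 α i ≠ ζ1 β j) →
      -- `h` is a function from `i0 × i1` to `sig`
      (∀ i < i0, ∀ j < i1, h i j < sig.ord) →
      ∃ α0 α1 : Ordinal.{u}, α0 < α1 ∧ α1 < mu.ord ∧
        ∀ i < i0, ∀ j < i1, c s(ζ0 α0 i, ζ1 α1 j) = h i j

/-!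
Write `κ = θ⁺` and `μ = κ⁺ ≤ ∂`, and let `λ = ∂⁺`. The proof colours pairs through minimal walks.

For `α < β < λ` the walk from `β` down to `α` follows a fixed ladder (a cofinal sequence of length
`cof x`) at every point `x` visited. If `δ < β` has cofinality `∂`, then the walks from `β` to all
points just below `δ` pass through `δ` (`exists_trace_eq_append`). A colour `h m`, where `h`
splits the points of cofinality `∂` into stationary pieces (`IsStat.exists_partition`), can
therefore be forced to occur on the walks between two small sets on either side of a suitable `m`.
What is left is to define the colour so that the point `m` can be *recognized* on the walk from
`y` to `x`.

To this end the points of a walk carry labels `g x < μ`, again from a partition into stationary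
pieces, so that any label can be made to occur on the part above `m` and on the part below `m`.
Let `N` be the largest label above `m` and `M` the largest label below `m`, with `N < M`. A
transitive function `e : [μ]² → κ` with small sublevel sets (`exists_transitive`) recognizes `N`
from the whole list of labels, as the label below `M` that maximizes `e · M` (`IsPivot`). The
first label above `N` behind an occurrence of `N` is then found at a position `k` (`IsBoundary`).
It lies below `m`, but not necessarily directly: a number `r` of smaller labels may precede it.
The number `r` is constant for stationarily many choices of the lower part, but it depends on the
sets considered, so it has to be guessed by another colouring `c₀ : [μ]² → ℕ` evaluated at the
pivot and at the label at position `k`. Then `m` stands at position `k - c₀(…)` (`labelBoundary`).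

The colouring `c₀` (`exists_colouring_nat`) has to realize every `r` on pairs `N < F l` with `N <
l` and `N` in a given unbounded set. It is built on `μ = κ⁺` by the same method, with the labels
replaced by the weights of the walk: the weight of `x` relative to the target `α` is the index of
the first ladder point of `x` that is at least `α`. Now the first label below `m` is already
large, so that no number `r` needs to be guessed.

This gives a colouring of pairs of sets of size at most `θ`, constant on the rectangle and taking
any prescribed colour from a set of size at most `λ` (`exists_colouring_small_sets`). To realize
an arbitrary function `h` on the rectangle, the colours are codes: ordinals below `λ ≤ 2 ^ χ` are
regarded as subsets of `χ`, and a code consists of fewer than `θ` points of `χ` that separate the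
members of a family, the traces of the members on these points, and the colours to be assigned. As
`χ ^ τ ≤ χ < λ` for `τ < θ`, unboundedly many of the families have the same separating points and
traces (`exists_stat_separated`), and the code lets every pair find its own colour (`decode_eq`).
-/

universe v

/-! ### Bounds below ordinals of large cofinality -/

theorem exists_bound_family {ι : Type v} {δ : Ordinal.{u}}
    (hι : Cardinal.lift.{u} #ι < Cardinal.lift.{v} δ.cof)
    (f : ι → Ordinal.{u}) (hf : ∀ i, f i < δ) : ∃ b < δ, ∀ i, f i < b := by
  have h1 : ⨆ i, f i + 1 < δ :=
    Ordinal.lift_iSup_add_one_lt_of_lt_cof (by rwa [← Ordinal.lift_cof]) hf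
  refine ⟨_, h1, fun i => (lt_add_one (f i)).trans_le (le_ciSup (f := fun i => f i + 1) ?_ i)⟩
  exact ⟨δ, by rintro _ ⟨i, rfl⟩; exact Order.add_one_le_of_lt (hf i)⟩

theorem exists_bound_set {δ : Ordinal.{u}} {s : Set Ordinal.{u}}
    (hs : #s < Cardinal.lift.{u + 1} δ.cof) (f : Ordinal.{u} → Ordinal.{u})
    (hf : ∀ x ∈ s, f x < δ) : ∃ b < δ, ∀ x ∈ s, f x < b := by
  obtain ⟨b, hb, h⟩ := exists_bound_family (ι := s) (δ := δ)
    (by rwa [Cardinal.lift_id'.{u, u + 1}]) (fun x => f x) (fun x => hf x x.2)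
  exact ⟨b, hb, fun x hx => h ⟨x, hx⟩⟩

theorem exists_bound_lt {δ τ : Ordinal.{u}} (hτ : τ.card < δ.cof)
    (f : Ordinal.{u} → Ordinal.{u}) (hf : ∀ i < τ, f i < δ) : ∃ b < δ, ∀ i < τ, f i < b :=
  exists_bound_set (s := Set.Iio τ) (by rwa [Cardinal.mk_Iio_ordinal, Cardinal.lift_lt]) f hf

theorem exists_bound_list {δ : Ordinal.{u}} (hδ : ℵ₀ ≤ δ.cof) (L : List Ordinal.{u})
    (f : Ordinal.{u} → Ordinal.{u}) (hf : ∀ x ∈ L, f x < δ) : ∃ b < δ, ∀ x ∈ L, f x < b :=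
  exists_bound_set (s := {x | x ∈ L})
    ((L.finite_toSet.lt_aleph0).trans_le (by rwa [aleph0_le_lift])) f hf

/-! ### Stationary sets -/

/-- Stationarity of a set of ordinals below the regular uncountable cardinal `c`: the set meets the
closure points of every function from `c` to itself.  As closed unbounded subsets of `c` and sets
of closure points of unary functions refine one another, this is the usual notion. -/
def IsStat (c : Cardinal.{u}) (A : Set Ordinal.{u}) : Prop :=
  ∀ f : Ordinal.{u} → Ordinal.{u}, (∀ ν < c.ord, f ν < c.ord) →
    ∃ δ ∈ A, δ < c.ord ∧ δ ≠ 0 ∧ ∀ ν < δ, f ν < δ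

section Stationary

variable {c d : Cardinal.{u}} {A B : Set Ordinal.{u}}

theorem IsStat.mono (hA : IsStat c A) (h : ∀ x ∈ A, x < c.ord → x ∈ B) : IsStat c B := by
  intro f hf
  obtain ⟨δ, h1, h2, h3⟩ := hA f hf
  exact ⟨δ, h δ h1 h2, h2, h3⟩

/-- A stationary set contains closure points of `f` that are limits and lie above a given `b`. -/
theorem IsStat.exists_gt (hc : ℵ₀ ≤ c) (hA : IsStat c A) (f : Ordinal.{u} → Ordinal.{u})
    (hf : ∀ ν < c.ord, f ν < c.ord) {b : Ordinal.{u}} (hb : b < c.ord) :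
    ∃ δ ∈ A, δ < c.ord ∧ b < δ ∧ (∀ ν < δ, f ν < δ) ∧ ∀ ν < δ, ν + 1 < δ := by
  have hl := (Cardinal.isSuccLimit_ord hc)
  obtain ⟨δ, h1, h2, h3, h4⟩ := hA (fun ν => max (f ν) (max (ν + 1) b)) (fun ν hν =>
    max_lt (hf ν hν) (max_lt (hl.add_one_lt hν) hb))
  refine ⟨δ, h1, h2, ?_, fun ν hν => ?_, fun ν hν => ?_⟩
  · exact (le_max_right _ _).trans (le_max_right _ _) |>.trans_lt (h4 0 (pos_iff_ne_zero.2 h3))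
  · exact (le_max_left _ _).trans_lt (h4 ν hν)
  · exact ((le_max_left _ _).trans (le_max_right _ _)).trans_lt (h4 ν hν)

theorem IsStat.exists_mem_gt (hc : ℵ₀ ≤ c) (hA : IsStat c A) {b : Ordinal.{u}} (hb : b < c.ord) :
    ∃ δ ∈ A, δ < c.ord ∧ b < δ := by
  obtain ⟨δ, h1, h2, h3, -⟩ := hA.exists_gt hc id (fun _ h => h) hb
  exact ⟨δ, h1, h2, h3⟩

theorem IsStat.inter_gt (hc : ℵ₀ ≤ c) (hA : IsStat c A) {b : Ordinal.{u}} (hb : b < c.ord)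
    (f : Ordinal.{u} → Ordinal.{u}) (hf : ∀ ν < c.ord, f ν < c.ord) :
    IsStat c {δ ∈ A | b < δ ∧ (∀ ν < δ, f ν < δ) ∧ ∀ ν < δ, ν + 1 < δ} := by
  intro g hg
  obtain ⟨δ, h1, h2, h3, h4, h5⟩ := hA.exists_gt hc (fun ν => max (f ν) (g ν))
    (fun ν hν => max_lt (hf ν hν) (hg ν hν)) hb
  exact ⟨δ, ⟨h1, h3, fun ν hν => (le_max_left _ _).trans_lt (h4 ν hν), h5⟩, h2,
    (pos_of_gt h3).ne', fun ν hν => (le_max_right _ _).trans_lt (h4 ν hν)⟩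

/-- A stationary set cannot be split into fewer than `c` nonstationary pieces. -/
theorem IsStat.exists_fiber (hc : c.IsRegular) (hA : IsStat c A) {ι : Type v}
    (hι : Cardinal.lift.{u} #ι < Cardinal.lift.{v} c) (g : Ordinal.{u} → ι) :
    ∃ k, IsStat c {δ ∈ A | g δ = k} := by
  by_contra! h
  simp only [IsStat, not_forall] at h
  choose F hF hF' using h
  -- the closure points of the pointwise bound `G` are closure points of every witness `F i`
  have h1 : ∀ ν < c.ord, ∃ b < c.ord, ∀ i, F i ν < b := fun ν hν =>
    exists_bound_family (by rwa [hc.cof_ord]) (fun i => F i ν) (fun i => hF i ν hν)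
  choose! G hG hG' using h1
  obtain ⟨δ, h1, h2, h3, h4⟩ := hA G hG
  exact hF' (g δ) ⟨δ, ⟨h1, rfl⟩, h2, h3, fun ν hν => (hG' ν (hν.trans h2) _).trans (h4 ν hν)⟩

/-- **Fodor's lemma**: a regressive function on a stationary set is constant on a stationary
subset. -/
theorem IsStat.exists_const (hc : c.IsRegular) (hA : IsStat c A) (R : Ordinal.{u} → Ordinal.{u})
    (hR : ∀ δ ∈ A, δ < c.ord → δ ≠ 0 → R δ < δ) :
    ∃ b < c.ord, IsStat c {δ ∈ A | R δ = b} := by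
  by_contra! h
  simp only [IsStat, not_forall] at h
  choose! F hF hF' using h
  -- the diagonal function: its closure points are closed under `F b` for all smaller `b`
  have h1 : ∀ ν < c.ord, ∃ b < c.ord, ∀ i < ν + 1, ∀ j < ν + 1, F i j < b := by
    intro ν hν
    have hν1 := (Cardinal.isSuccLimit_ord hc.1).add_one_lt hν
    have hcard : (ν + 1).card < c.ord.cof := by
      rw [hc.cof_ord]; exact Cardinal.lt_ord.1 hν1
    have h1 : ∀ i < ν + 1, ∃ b < c.ord, ∀ j < ν + 1, F i j < b := fun i hi =>
      exists_bound_lt hcard (F i) (fun j hj => hF i (hi.trans hν1) j (hj.trans hν1))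
    choose! b hb hbF using h1
    obtain ⟨b', hb', hbb⟩ := exists_bound_lt hcard b hb
    exact ⟨b', hb', fun i hi j hj => (hbF i hi j hj).trans (hbb i hi)⟩
  choose! G hG hG' using h1
  obtain ⟨δ, h1, h2, h3, h4⟩ := hA G hG
  have hRδ := hR δ h1 h2 h3
  refine hF' (R δ) (hRδ.trans h2) ⟨δ, ⟨h1, rfl⟩, h2, h3, fun ν hν => ?_⟩
  have hm : max (R δ) ν < δ := max_lt hRδ hν
  exact (hG' _ (hm.trans h2) _ (Order.lt_add_one_iff.2 (le_max_left _ _)) _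
    (Order.lt_add_one_iff.2 (le_max_right _ _))).trans (h4 _ hm)

/-- The version of `IsStat.exists_fiber` for a function to the ordinals below some `τ < c`; it
follows from Fodor's lemma, as the function is regressive above `τ`. -/
theorem IsStat.exists_fiber_ord (hc : c.IsRegular) (hA : IsStat c A) {τ : Ordinal.{u}}
    (hτ : τ < c.ord) (g : Ordinal.{u} → Ordinal.{u}) (hg : ∀ δ ∈ A, δ < c.ord → g δ < τ) :
    ∃ b < τ, IsStat c {δ ∈ A | g δ = b} := by
  obtain ⟨b, -, h⟩ := ((hA.inter_gt hc.1 hτ id fun _ h => h).mono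
    (B := {δ ∈ A | τ < δ ∧ δ < c.ord}) fun x hx hx' => ⟨hx.1, hx.2.1, hx'⟩).exists_const hc g
    fun δ hδ _ _ => (hg δ hδ.1 hδ.2.2).trans hδ.2.1
  obtain ⟨δ, hδ, hδc, -⟩ := h.exists_mem_gt hc.1 hτ
  exact ⟨b, hδ.2 ▸ hg δ hδ.1.1 hδc, h.mono fun x hx _ => ⟨hx.1.1, hx.2⟩⟩

/-- The ordinals of cofinality `d` form a stationary subset of `d⁺`, for `d` regular: the
`d`-th iterate of a closure process is a closure point of cofinality `d`. -/
theorem isStat_cof (hd : d.IsRegular) : IsStat (Order.succ d) {δ : Ordinal.{u} | δ.cof = d} := by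
  intro f hf
  set o := (Order.succ d).ord with ho
  have hreg : (Order.succ d).IsRegular := isRegular_succ hd.1
  have hl := (Cardinal.isSuccLimit_ord hreg.1)
  have hcof : o.cof = Order.succ d := hreg.cof_ord
  have hlt : ∀ x < o, x.card < o.cof := fun x hx => by rw [hcof]; exact Cardinal.lt_ord.1 hx
  have hstep : ∀ x < o, ∃ b, b < o ∧ x < b ∧ ∀ ν < x + 1, f ν < b := by
    intro x hx
    obtain ⟨b, hb, h⟩ := exists_bound_lt (hlt _ (hl.add_one_lt hx)) f
      (fun ν hν => hf ν (hν.trans (hl.add_one_lt hx)))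
    exact ⟨max b (x + 1), max_lt hb (hl.add_one_lt hx),
      (lt_add_one x).trans_le (le_max_right _ _), fun ν hν => (h ν hν).trans_le (le_max_left _ _)⟩
  choose! s hs using hstep
  -- `G ξ` is the `ξ`-th iterate of `s`, with suprema at limits
  let G : Ordinal.{u} → Ordinal.{u} := WellFounded.fix Ordinal.lt_wf
    (fun ξ ih => ⨆ i : Set.Iio ξ, s (ih i.1 i.2))
  have hG : ∀ ξ, G ξ = ⨆ i : Set.Iio ξ, s (G i.1) := fun ξ => WellFounded.fix_eq _ _ ξ
  have hle : ∀ ξ, ∀ i < ξ, s (G i) ≤ G ξ := by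
    intro ξ i hi
    rw [hG ξ]
    exact Ordinal.le_iSup (fun i : Set.Iio ξ => s (G i.1)) ⟨i, hi⟩
  have hGo : ∀ ξ ≤ d.ord, G ξ < o := by
    intro ξ
    induction ξ using WellFoundedLT.induction with
    | ind ξ ih =>
      intro hξ
      obtain ⟨b, hb, h⟩ := exists_bound_lt (δ := o) (τ := ξ) (hlt ξ (hξ.trans_lt
        (Cardinal.ord_lt_ord.2 (Order.lt_succ d)))) (fun i => s (G i))
        (fun i hi => (hs _ (ih i hi (hi.le.trans hξ))).1)
      rw [hG ξ]
      refine (Ordinal.iSup_le fun i => ?_).trans_lt hb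
      exact (h i.1 i.2).le
  have hmono : ∀ ξ ≤ d.ord, ∀ i < ξ, G i < G ξ := fun ξ hξ i hi =>
    (hs _ (hGo i (hi.le.trans hξ))).2.1.trans_le (hle ξ i hi)
  have hdl := (Cardinal.isSuccLimit_ord hd.1)
  have hex : ∀ ν < G d.ord, ∃ i < d.ord, ν < G i := by
    intro ν hν
    rw [hG d.ord, Ordinal.lt_iSup_iff] at hν
    obtain ⟨⟨i, hi⟩, h⟩ := hν
    exact ⟨i + 1, hdl.add_one_lt hi, h.trans_le (hle _ _ (lt_add_one i))⟩
  have hpos : (0 : Ordinal) < d.ord := hd.ord_pos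
  refine ⟨G d.ord, ?_, hGo _ le_rfl, (zero_le.trans_lt (hmono _ le_rfl 0 hpos)).ne', ?_⟩
  · have h1 : G d.ord = ⨆ i : Set.Iio d.ord, G i.1 := by
      apply le_antisymm
      · refine le_of_forall_lt fun ν hν => ?_
        obtain ⟨i, hi, h⟩ := hex ν hν
        exact h.trans_le (Ordinal.le_iSup (fun i : Set.Iio d.ord => G i.1) ⟨i, hi⟩)
      · exact Ordinal.iSup_le fun i => (hmono _ le_rfl i.1 i.2).le
    change (G d.ord).cof = d
    rw [h1, Ordinal.cof_iSup_Iio (f := fun i : Set.Iio d.ord => G i.1) _ hdl.isSuccPrelimit,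
      hd.cof_ord]
    intro i j hij
    exact hmono j.1 (le_of_lt j.2) i.1 hij
  · intro ν hν
    obtain ⟨i, hi, h⟩ := hex ν hν
    have h2 := (hs (G i) (hGo i hi.le)).2.2 ν (h.trans (lt_add_one _))
    exact h2.trans_le (hle _ _ hi)

/-- The limit of the iterates of a closure process is a closure point. -/
theorem isStat_univ (hc : c.IsRegular) (hc' : ℵ₀ < c) : IsStat c Set.univ := by
  intro f hf
  have hl := Cardinal.isSuccLimit_ord hc.1
  have hstep : ∀ x < c.ord, ∃ b, b < c.ord ∧ x < b ∧ ∀ ν < x, f ν < b := by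
    intro x hx
    obtain ⟨b, hb, h⟩ := exists_bound_lt (by rw [hc.cof_ord]; exact Cardinal.lt_ord.1 hx) f
      (fun ν hν => hf ν (hν.trans hx))
    exact ⟨max b (x + 1), max_lt hb (hl.add_one_lt hx),
      (lt_add_one x).trans_le (le_max_right _ _), fun ν hν => (h ν hν).trans_le (le_max_left _ _)⟩
  choose! s hs using hstep
  have hlt : ∀ n : ℕ, s^[n] 0 < c.ord := by
    intro n
    induction n with
    | zero => exact hc.ord_pos
    | succ n ih => rw [Function.iterate_succ_apply']; exact (hs _ ih).1
  obtain ⟨b, hb, h⟩ := exists_bound_family (ι := ℕ) (δ := c.ord)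
    (by simpa [hc.cof_ord] using hc') (fun n => s^[n] 0) hlt
  have hbdd : BddAbove (Set.range fun n : ℕ => s^[n] 0) :=
    ⟨b, by rintro _ ⟨n, rfl⟩; exact (h n).le⟩
  have hle : ∀ n : ℕ, s (s^[n] 0) ≤ ⨆ n : ℕ, s^[n] 0 := fun n => by
    rw [← Function.iterate_succ_apply' s n 0]
    exact le_ciSup hbdd (n + 1)
  refine ⟨⨆ n : ℕ, s^[n] 0, trivial, (ciSup_le fun n => (h n).le).trans_lt hb,
    (pos_of_gt ((hs _ (hlt 0)).2.1.trans_le (hle 0))).ne', fun ν hν => ?_⟩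
  obtain ⟨n, hn⟩ := exists_lt_of_lt_ciSup hν
  exact ((hs _ (hlt n)).2.2 ν hn).trans_le (hle n)

theorem IsStat.lift_le_mk (hc : c.IsRegular) (hA : IsStat c A) :
    Cardinal.lift.{u + 1} c ≤ #{δ ∈ A | δ < c.ord} := by
  by_contra! h
  obtain ⟨b, hb, h1⟩ := exists_bound_set (δ := c.ord) (by rwa [hc.cof_ord]) id
    (s := {δ ∈ A | δ < c.ord}) (fun x hx => hx.2)
  obtain ⟨δ, h2, h3, h4⟩ := hA.exists_mem_gt hc.1 hb
  exact (h1 δ ⟨h2, h3⟩).not_gt h4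

theorem exists_injOn_of_card_le {d : Cardinal.{u}} {ξ : Ordinal.{u}} (hξ : ξ.card ≤ d) :
    ∃ f : Ordinal.{u} → Ordinal.{u}, (∀ η < ξ, f η < d.ord) ∧
      ∀ η < ξ, ∀ η' < ξ, f η = f η' → η = η' := by
  have : #(Set.Iio ξ) ≤ #(Set.Iio d.ord) := by
    rw [Cardinal.mk_Iio_ordinal, Cardinal.mk_Iio_ordinal, Cardinal.lift_le, Cardinal.card_ord]
    exact hξ
  obtain ⟨g⟩ := this
  classical
  refine ⟨fun η => if h : η < ξ then (g ⟨η, h⟩).1 else 0, fun η h => ?_, fun η h η' h' he => ?_⟩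
  · simp only [h, dif_pos]
    exact (g ⟨η, h⟩).2
  · simp only [h, h', dif_pos] at he
    have := g.injective (Subtype.ext he)
    exact congrArg Subtype.val this

/-- **Ulam's theorem** for the successor of a regular cardinal `d`: a stationary set can be split
into `d⁺` stationary pieces. -/
theorem IsStat.exists_partition (hd : d.IsRegular) (hA : IsStat (Order.succ d) A) {K : Type v}
    [Nonempty K] (hK : Cardinal.lift.{u} #K ≤ Cardinal.lift.{v} (Order.succ d)) :
    ∃ h : Ordinal.{u} → K, ∀ k, IsStat (Order.succ d) {δ ∈ A | h δ = k} := by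
  have hc : (Order.succ d).IsRegular := isRegular_succ hd.1
  set c := Order.succ d with hcd
  have h1 : ∀ ξ < c.ord, ∃ f : Ordinal.{u} → Ordinal.{u},
      (∀ η < ξ, f η < d.ord) ∧ ∀ η < ξ, ∀ η' < ξ, f η = f η' → η = η' := fun ξ hξ =>
    exists_injOn_of_card_le (Order.lt_succ_iff.1 (Cardinal.lt_ord.1 hξ))
  choose! e he using h1
  have hdc : d.ord < c.ord := Cardinal.ord_lt_ord.2 (Order.lt_succ d)
  classical
  -- the matrix of sets `{δ | e δ η = ζ}` has a stationary entry in every row `η`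
  have h2 : ∀ η < c.ord, ∃ ζ < d.ord, IsStat c {δ ∈ A | η < δ ∧ e δ η = ζ} := by
    intro η hη
    obtain ⟨ζ, hζd, hζ⟩ := (hA.inter_gt hc.1 hη id (fun _ h => h)).exists_fiber_ord hc hdc
      (fun δ => e δ η) (fun δ hδ hδc => (he δ hδc).1 η hδ.2.1)
    exact ⟨ζ, hζd, hζ.mono fun δ hδ _ => ⟨hδ.1.1, hδ.1.2.1, hδ.2⟩⟩
  choose! ζ hζd hζ using h2
  -- one column `z` serves `c` many rows, and these are disjoint within the column
  obtain ⟨z, -, hz⟩ := (isStat_univ hc (hd.1.trans_lt (Order.lt_succ d))).exists_fiber_ord hc hdc ζ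
    (fun η _ hη => hζd η hη)
  have h3 := hz.lift_le_mk hc
  have h4 : Cardinal.lift.{u + 1} #K ≤
      Cardinal.lift.{v} #{δ ∈ {δ ∈ Set.univ | ζ δ = z} | δ < c.ord} := by
    have := (Cardinal.lift_le.{max (u + 1) v}).2 hK
    have h3' := (Cardinal.lift_le.{v}).2 h3
    refine le_trans ?_ h3'
    rw [Cardinal.lift_lift] at this ⊢
    have h5 := (Cardinal.lift_le.{u + 1}).2 hK
    simpa only [Cardinal.lift_lift, Cardinal.lift_umax] using h5
  obtain ⟨j⟩ := Cardinal.lift_mk_le'.1 h4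
  refine ⟨fun δ => if h : ∃ k, (j k).1 < δ ∧ e δ (j k).1 = z then h.choose
    else Classical.arbitrary K, fun k => ?_⟩
  have hjk := (j k).2
  refine (hζ (j k).1 hjk.2).mono fun δ hδ hδc => ⟨hδ.1, ?_⟩
  have hz' : ζ (j k).1 = z := hjk.1.2
  have h : ∃ k, (j k).1 < δ ∧ e δ (j k).1 = z := ⟨k, hδ.2.1, by rw [hδ.2.2, hz']⟩
  simp only [h, dif_pos]
  have hs := h.choose_spec
  have := (he δ hδc).2 _ hs.1 _ hδ.2.1 (by rw [hs.2, hδ.2.2, hz'])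
  exact j.injective (Subtype.ext this)

end Stationary

/-! ### Minimal walks -/

/-- The `i`-th point of a fixed strictly increasing cofinal sequence of length `cof x` in `x`. -/
noncomputable def ladder (x i : Ordinal.{u}) : Ordinal.{u} :=
  open Classical in
  if h : i < x.cof.ord then ((exists_isFundamentalSeq (o := x) rfl).choose ⟨i, h⟩).1 else 0

theorem ladder_lt {x i : Ordinal.{u}} (hi : i < x.cof.ord) : ladder x i < x := by
  rw [ladder, dif_pos hi]
  exact ((exists_isFundamentalSeq (o := x) rfl).choose ⟨i, hi⟩).2

theorem ladder_lt_ladder {x i j : Ordinal.{u}} (hij : i < j) (hj : j < x.cof.ord) :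
    ladder x i < ladder x j := by
  rw [ladder, dif_pos (hij.trans hj), ladder, dif_pos hj]
  exact (exists_isFundamentalSeq (o := x) rfl).choose_spec.strictMono
    (show (⟨i, hij.trans hj⟩ : Set.Iio x.cof.ord) < ⟨j, hj⟩ from hij)

theorem exists_le_ladder {x α : Ordinal.{u}} (h : α < x) :
    ∃ i < x.cof.ord, α ≤ ladder x i := by
  obtain ⟨_, ⟨i, rfl⟩, hi⟩ :=
    (exists_isFundamentalSeq (o := x) rfl).choose_spec.isCofinal_range ⟨α, h⟩
  refine ⟨i.1, i.2, ?_⟩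
  rw [ladder, dif_pos (show i.1 < x.cof.ord from i.2)]
  exact hi

/-- The index of the first ladder point of `x` that is at least `α`. -/
noncomputable def weight (x α : Ordinal.{u}) : Ordinal.{u} :=
  sInf {i | i < x.cof.ord ∧ α ≤ ladder x i}

theorem weight_spec {x α : Ordinal.{u}} (h : α < x) :
    weight x α < x.cof.ord ∧ α ≤ ladder x (weight x α) := by
  obtain ⟨i, hi⟩ := exists_le_ladder h
  exact csInf_mem (s := {i | i < x.cof.ord ∧ α ≤ ladder x i}) ⟨i, hi⟩

theorem ladder_lt_of_lt_weight {x α i : Ordinal.{u}} (h : α < x) (hi : i < weight x α) :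
    ladder x i < α := by
  by_contra! h'
  exact (csInf_le' (s := {i | i < x.cof.ord ∧ α ≤ ladder x i})
    ⟨hi.trans (weight_spec h).1, h'⟩).not_gt hi

theorem weight_eq {x α k : Ordinal.{u}} (h : α < x) (hk : k < x.cof.ord) (h1 : α ≤ ladder x k)
    (h2 : ∀ i < k, ladder x i < α) : weight x α = k := by
  apply le_antisymm
  · exact csInf_le' (s := {i | i < x.cof.ord ∧ α ≤ ladder x i}) ⟨hk, h1⟩
  · by_contra! h'
    exact (h2 _ h').not_ge (weight_spec h).2

/-- Weights relative to points close to `x` are large. -/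
theorem exists_le_weight {x : Ordinal.{u}} {i : Ordinal.{u}} (hi : i < x.cof.ord) :
    ∃ b < x, ∀ α, b ≤ α → α < x → i ≤ weight x α := by
  refine ⟨ladder x i, ladder_lt hi, fun α h1 h2 => ?_⟩
  by_contra! h
  exact ((weight_spec h2).2.trans_lt (ladder_lt_ladder h hi)).not_ge h1

/-- The next point after `x` on the walk from `x` down to `α`. -/
noncomputable def walkStep (x α : Ordinal.{u}) : Ordinal.{u} := ladder x (weight x α)

theorem walkStep_lt {x α : Ordinal.{u}} (h : α < x) : walkStep x α < x :=
  ladder_lt (weight_spec h).1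

theorem le_walkStep {x α : Ordinal.{u}} (h : α < x) : α ≤ walkStep x α :=
  (weight_spec h).2

/-- The points visited by the walk from `β` down to `α`, in decreasing order, with the end point
`α` left out. -/
noncomputable def trace (β α : Ordinal.{u}) : List Ordinal.{u} :=
  open Classical in
  if _h : α < β then β :: trace (walkStep β α) α else []
termination_by β
decreasing_by exact walkStep_lt _h

theorem trace_of_lt {β α : Ordinal.{u}} (h : α < β) :
    trace β α = β :: trace (walkStep β α) α := by
  rw [trace, dif_pos h]

theorem trace_self (α : Ordinal.{u}) : trace α α = [] := by
  rw [trace, dif_neg (lt_irrefl α)]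

theorem mem_trace {β α x : Ordinal.{u}} (hx : x ∈ trace β α) : α < x ∧ x ≤ β := by
  induction β using WellFoundedLT.induction with
  | ind β ih =>
    by_cases h : α < β
    · rw [trace_of_lt h, List.mem_cons] at hx
      rcases hx with rfl | hx
      · exact ⟨h, le_rfl⟩
      · have := ih _ (walkStep_lt h) hx
        exact ⟨this.1, this.2.trans (walkStep_lt h).le⟩
    · rw [trace, dif_neg h] at hx
      simp at hx

/-- If the ladder of `x` has length at most `cof δ`, it does not accumulate at `δ`; hence the walk
from `x` to any point just below `δ` starts like the walk to `δ`. -/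
theorem exists_weight_eq {d : Cardinal.{u}} {δ x : Ordinal.{u}} (hδ : δ.cof = d) (hx : δ < x)
    (hxd : x.cof ≤ d) : ∃ b < δ, ∀ α, b ≤ α → α < δ → weight x α = weight x δ := by
  have hk := weight_spec hx
  obtain ⟨b, hb, h⟩ := exists_bound_lt (δ := δ) (τ := weight x δ)
    (by rw [hδ]; exact (Cardinal.lt_ord.1 hk.1).trans_le hxd) (ladder x)
    (fun i hi => ladder_lt_of_lt_weight hx hi)
  refine ⟨b, hb, fun α h1 h2 => weight_eq (h2.trans hx) hk.1 (h2.le.trans hk.2) fun i hi => ?_⟩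
  exact (h i hi).trans_le h1

/-- Walks from `β` to points just below `δ` pass through `δ`, when `δ` has cofinality `d` and
`δ < β < d⁺`. -/
theorem exists_trace_eq_append {d : Cardinal.{u}} {δ β : Ordinal.{u}} (hδ : δ.cof = d)
    (h : δ < β) (hβ : β < (Order.succ d).ord) : ∃ b < δ, ∀ α, b ≤ α → α < δ →
      trace β α = trace β δ ++ trace δ α ∧ ∀ x ∈ trace β δ, weight x α = weight x δ := by
  induction β using WellFoundedLT.induction with
  | ind β ih =>
    obtain ⟨b, hb, hw⟩ := exists_weight_eq hδ h
      ((cof_le_card β).trans (Order.lt_succ_iff.1 (Cardinal.lt_ord.1 hβ)))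
    rcases (le_walkStep h).eq_or_lt with h' | h'
    · refine ⟨b, hb, fun α h1 h2 => ?_⟩
      rw [trace_of_lt h, trace_of_lt (h2.trans h), walkStep, hw α h1 h2, ← walkStep, ← h',
        trace_self]
      refine ⟨rfl, fun x hx => ?_⟩
      rw [List.mem_singleton.1 hx]
      exact hw α h1 h2
    · obtain ⟨b', hb', ih⟩ := ih _ (walkStep_lt h) h' ((walkStep_lt h).trans hβ)
      refine ⟨max b b', max_lt hb hb', fun α h1 h2 => ?_⟩
      have ih := ih α ((le_max_right _ _).trans h1) h2
      have hw := hw α ((le_max_left _ _).trans h1) h2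
      rw [trace_of_lt h, trace_of_lt (h2.trans h), walkStep, hw, ← walkStep, ih.1]
      refine ⟨rfl, fun x hx => ?_⟩
      rcases List.mem_cons.1 hx with rfl | hx
      · exact hw
      · exact ih.2 x hx

/-- For a stationary set `A` of ordinals of cofinality `d` and any `F`, from some `c` on every `α`
is the end of a walk that starts at a value `F p` with `p ∈ A` and visits `p`; moreover `α` may be
assumed to be above the value of a given regressive function at `p`. -/
theorem IsStat.exists_mem_trace {d : Cardinal.{u}} (hd : d.IsRegular) {A : Set Ordinal.{u}}
    (hA : IsStat (Order.succ d) A) (hAd : ∀ p ∈ A, p.cof = d) {F : Ordinal.{u} → Ordinal.{u}}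
    (hF : ∀ p < (Order.succ d).ord, p < F p ∧ F p < (Order.succ d).ord)
    (R : Ordinal.{u} → Ordinal.{u}) (hR : ∀ p ∈ A, R p < p) :
    ∃ c < (Order.succ d).ord, ∀ α < (Order.succ d).ord, c ≤ α →
      ∃ p ∈ A, p < (Order.succ d).ord ∧ α < p ∧ R p ≤ α ∧ p ∈ trace (F p) α := by
  have hc : (Order.succ d).IsRegular := isRegular_succ hd.1
  have h1 : ∀ p, p ∈ A ∧ p < (Order.succ d).ord → ∃ b < p, ∀ α, b ≤ α → α < p →
      R p ≤ α ∧ p ∈ trace (F p) α := by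
    intro p hp
    obtain ⟨b, hb, h2⟩ := exists_trace_eq_append (hAd p hp.1) (hF p hp.2).1 (hF p hp.2).2
    refine ⟨max b (R p), max_lt hb (hR p hp.1), fun α h3 h4 => ⟨(le_max_right _ _).trans h3, ?_⟩⟩
    rw [(h2 α ((le_max_left _ _).trans h3) h4).1, trace_of_lt h4]
    simp
  choose! b hb hbt using h1
  obtain ⟨c, hcc, hst⟩ := (hA.mono (B := {p ∈ A | p < (Order.succ d).ord})
    fun x hx hx' => ⟨hx, hx'⟩).exists_const hc b (fun p hp _ _ => hb p hp)
  refine ⟨c, hcc, fun α hα hcα => ?_⟩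
  obtain ⟨p, ⟨hp, hpc⟩, hp', hαp⟩ := hst.exists_mem_gt hc.1 hα
  exact ⟨p, hp.1, hp', hαp, hbt p hp α (hpc ▸ hcα) hαp⟩

/-! ### A transitive, locally small function on a successor cardinal -/

/-- The relation generating the transitive function below: `α` is one of the elements of `γ`
numbered at most `η` by `j γ`. -/
def EnumLE (j : Ordinal.{u} → Ordinal.{u} → Ordinal.{u}) (η α γ : Ordinal.{u}) : Prop :=
  α < γ ∧ j γ α ≤ η

/-- Fewer than `τ` ordinals can be reached from `γ`: each step has fewer than `τ` possible results,
and descending chains are finite. -/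
theorem mk_transGen_enumLE_lt {ν : Cardinal.{u}} {j : Ordinal.{u} → Ordinal.{u} → Ordinal.{u}}
    (hj : ∀ γ < (Order.succ ν).ord, ∀ α < γ, ∀ β < γ, j γ α = j γ β → α = β)
    {η : Ordinal.{u}} {τ : Cardinal.{u}} (hτ : τ.IsRegular) (hη : η.card < τ) {γ : Ordinal.{u}}
    (hγ : γ < (Order.succ ν).ord) :
    #{α | Relation.TransGen (EnumLE j η) α γ} < Cardinal.lift.{u + 1} τ := by
  induction γ using WellFoundedLT.induction with
  | ind γ ih =>
    have hτ' : (Cardinal.lift.{u + 1} τ).IsRegular := hτ.lift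
    have h1 : #{β | EnumLE j η β γ} < Cardinal.lift.{u + 1} τ := by
      have h2 : #(j γ '' {β | EnumLE j η β γ}) = #{β | EnumLE j η β γ} :=
        Cardinal.mk_image_eq_of_injOn _ _ fun α hα β hβ h => hj γ hγ α hα.1 β hβ.1 h
      rw [← h2]
      have h3 : #(Set.Iio (η + 1)) < Cardinal.lift.{u + 1} τ := by
        rw [Cardinal.mk_Iio_ordinal, Cardinal.lift_lt]
        exact Cardinal.lt_ord.1 ((Cardinal.isSuccLimit_ord hτ.1).add_one_lt (Cardinal.lt_ord.2 hη))
      refine (Cardinal.mk_le_mk_of_subset ?_).trans_lt h3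
      rintro _ ⟨β, hβ, rfl⟩
      exact Order.lt_add_one_iff.2 hβ.2
    have h2 : #(⋃ β ∈ {β | EnumLE j η β γ}, {α | Relation.TransGen (EnumLE j η) α β}) <
        Cardinal.lift.{u + 1} τ :=
      (Cardinal.card_biUnion_lt_iff_forall_of_isRegular hτ' h1).2
        fun β hβ => ih β hβ.1 (hβ.1.trans hγ)
    refine (Cardinal.mk_le_mk_of_subset ?_).trans_lt
      ((Cardinal.mk_union_le _ _).trans_lt (Cardinal.add_lt_of_lt hτ'.1 h1 h2))
    intro α hα
    rcases Relation.TransGen.tail'_iff.1 hα with ⟨β, h3, h4⟩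
    rcases Relation.reflTransGen_iff_eq_or_transGen.1 h3 with rfl | h5
    · exact Or.inl h4
    · exact Or.inr (Set.mem_biUnion (x := β) h4 h5)

/-- On `ν⁺` there is a transitive function to `ν` with small sublevel sets: `e α γ` is the least `η`
such that `γ` can be connected with `α` by a descending chain in which every ordinal is followed by
one of its elements numbered at most `η`. -/
theorem exists_transitive (ν : Cardinal.{u}) :
    ∃ e : Ordinal.{u} → Ordinal.{u} → Ordinal.{u},
      (∀ γ < (Order.succ ν).ord, ∀ α < γ, e α γ < ν.ord) ∧
      (∀ γ < (Order.succ ν).ord, ∀ β < γ, ∀ α < β, e α γ ≤ max (e α β) (e β γ)) ∧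
      ∀ γ < (Order.succ ν).ord, ∀ (η : Ordinal.{u}) (τ : Cardinal.{u}), τ.IsRegular → η.card < τ →
        #{α | α < γ ∧ e α γ ≤ η} < Cardinal.lift.{u + 1} τ := by
  have h1 : ∀ ξ < (Order.succ ν).ord, ∃ f : Ordinal.{u} → Ordinal.{u},
      (∀ η < ξ, f η < ν.ord) ∧ ∀ η < ξ, ∀ η' < ξ, f η = f η' → η = η' := fun ξ hξ =>
    exists_injOn_of_card_le (Order.lt_succ_iff.1 (Cardinal.lt_ord.1 hξ))
  choose! j hj using h1
  have hle : ∀ α γ, α < γ → sInf {η | Relation.TransGen (EnumLE j η) α γ} ≤ j γ α :=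
    fun α γ h => csInf_le' (Relation.TransGen.single ⟨h, le_rfl⟩)
  have hmem : ∀ α γ, α < γ → ∀ η, sInf {η | Relation.TransGen (EnumLE j η) α γ} ≤ η →
      Relation.TransGen (EnumLE j η) α γ := by
    intro α γ h η hη
    have : Relation.TransGen (EnumLE j (sInf {η | Relation.TransGen (EnumLE j η) α γ})) α γ :=
      csInf_mem (s := {η | Relation.TransGen (EnumLE j η) α γ})
      ⟨j γ α, Relation.TransGen.single ⟨h, le_rfl⟩⟩
    exact Relation.TransGen.mono (r := EnumLE j _) (fun a b hab => ⟨hab.1, hab.2.trans hη⟩) α γ this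
  refine ⟨fun α γ => sInf {η | Relation.TransGen (EnumLE j η) α γ}, fun γ hγ α hα => ?_,
    fun γ hγ β hβ α hα => ?_, fun γ hγ η τ hτ hη => ?_⟩
  · exact (hle α γ hα).trans_lt ((hj γ hγ).1 α hα)
  · exact csInf_le' ((hmem α β hα _ (le_max_left _ _)).trans (hmem β γ hβ _ (le_max_right _ _)))
  · refine (Cardinal.mk_le_mk_of_subset ?_).trans_lt
      (mk_transGen_enumLE_lt (ν := ν) (fun γ hγ => (hj γ hγ).2)
        hτ hη hγ)
    exact fun α hα => hmem α γ hα.1 η hα.2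

/-! ### Locating a boundary in a list of labels -/

/-- The entry of `L`, other than its maximum `M`, that the list puts on top: it maximizes `e · M`
among the entries below `M`, and is the largest one to do so. -/
def IsPivot (e : Ordinal.{u} → Ordinal.{u} → Ordinal.{u}) (L : List Ordinal.{u})
    (N : Ordinal.{u}) : Prop :=
  ∃ M ∈ L, (∀ y ∈ L, y ≤ M) ∧ N ∈ L ∧ N < M ∧
    ∀ y ∈ L, y < M → e y M < e N M ∨ e y M = e N M ∧ y ≤ N

/-- `k` is the first position behind an occurrence of the pivot `N` that carries a larger entry. -/
def IsBoundary (e : Ordinal.{u} → Ordinal.{u} → Ordinal.{u}) (L : List Ordinal.{u})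
    (N : Ordinal.{u}) (k : ℕ) : Prop :=
  IsPivot e L N ∧ N ∈ L.take k ∧ (∃ y, L[k]? = some y ∧ N < y) ∧
    ∀ k' < k, N ∈ L.take k' → ∀ y, L[k']? = some y → y ≤ N

theorem IsPivot.unique {e : Ordinal.{u} → Ordinal.{u} → Ordinal.{u}} {L : List Ordinal.{u}}
    {N N' : Ordinal.{u}} (h : IsPivot e L N) (h' : IsPivot e L N') : N = N' := by
  obtain ⟨M, hM, h1, h2, h3, h4⟩ := h
  obtain ⟨M', hM', h1', h2', h3', h4'⟩ := h'
  obtain rfl : M = M' := le_antisymm (h1' M hM) (h1 M' hM')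
  rcases h4 N' h2' h3' with h5 | h5 <;> rcases h4' N h2 h3 with h6 | h6
  · exact absurd h5 h6.asymm
  · exact absurd h6.1.symm h5.ne
  · exact absurd h5.1.symm h6.ne
  · exact le_antisymm h6.2 h5.2

theorem IsBoundary.unique {e : Ordinal.{u} → Ordinal.{u} → Ordinal.{u}} {L : List Ordinal.{u}}
    {N N' : Ordinal.{u}} {k k' : ℕ} (h : IsBoundary e L N k) (h' : IsBoundary e L N' k') :
    N = N' ∧ k = k' := by
  obtain rfl := h.1.unique h'.1
  obtain ⟨-, h1, ⟨y, hy, hNy⟩, h2⟩ := h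
  obtain ⟨-, h1', ⟨y', hy', hNy'⟩, h2'⟩ := h'
  refine ⟨rfl, ?_⟩
  rcases lt_trichotomy k k' with h | h | h
  · exact absurd (h2' k h h1 y hy) hNy.not_ge
  · exact h
  · exact absurd (h2 k' h h1' y' hy') hNy'.not_ge

/-- The list `ρ` of labels above a point, followed by the list `τ ++ j :: σ` of labels below it,
has its boundary at `j`, the first label exceeding the maximum `N` of `ρ`. It suffices that `N`
dominates the labels below the point strictly, and those above it weakly, as seen from the maximum
`M` of the whole list. -/
theorem isBoundary_append {e : Ordinal.{u} → Ordinal.{u} → Ordinal.{u}}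
    {ρ τ σ : List Ordinal.{u}} {N j M : Ordinal.{u}} (hN : N ∈ ρ) (hρ : ∀ y ∈ ρ, y ≤ N)
    (hτ : ∀ y ∈ τ, y ≤ N) (hj : N < j) (hM : M ∈ τ ++ j :: σ) (hM' : ∀ y ∈ τ ++ j :: σ, y ≤ M)
    (hσ : ∀ y ∈ τ ++ j :: σ, y < M → e y M < e N M) (hρ' : ∀ y ∈ ρ, y < N → e y M ≤ e N M) :
    IsBoundary e (ρ ++ (τ ++ j :: σ)) N (ρ.length + τ.length) := by
  have hNM : N < M := hj.trans_le (hM' j (by simp))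
  refine ⟨⟨M, List.mem_append_right _ hM, fun y hy => ?_, List.mem_append_left _ hN, hNM,
    fun y hy hyM => ?_⟩, ?_, ⟨j, ?_, hj⟩, fun k' hk' _ y hy => ?_⟩
  · rcases List.mem_append.1 hy with h | h
    · exact (hρ y h).trans hNM.le
    · exact hM' y h
  · rcases List.mem_append.1 hy with h | h
    · rcases (hρ y h).eq_or_lt with rfl | h'
      · exact Or.inr ⟨rfl, le_rfl⟩
      · rcases (hρ' y h h').lt_or_eq with h'' | h''
        · exact Or.inl h''
        · exact Or.inr ⟨h'', h'.le⟩
    · exact Or.inl (hσ y h hyM)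
  · rw [List.take_append]
    refine List.mem_append_left _ ?_
    rw [List.take_of_length_le (by omega)]
    exact hN
  · rw [← List.append_assoc, List.getElem?_append_right (by simp)]
    simp
  · rw [← List.append_assoc, List.getElem?_append_left (by simpa using hk')] at hy
    rcases List.mem_append.1 (List.mem_of_getElem? hy) with h | h
    · exact hρ y h
    · exact hτ y h

/-- The pivot and the boundary position of a list of labels, with a default value if there is
none. -/
noncomputable def boundary (e : Ordinal.{u} → Ordinal.{u} → Ordinal.{u}) (L : List Ordinal.{u}) :
    Ordinal.{u} × ℕ :=
  open Classical in
  if h : ∃ p : Ordinal.{u} × ℕ, IsBoundary e L p.1 p.2 then h.choose else (0, 0)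

theorem IsBoundary.boundary_eq {e : Ordinal.{u} → Ordinal.{u} → Ordinal.{u}} {L : List Ordinal.{u}}
    {N : Ordinal.{u}} {k : ℕ} (h : IsBoundary e L N k) : boundary e L = (N, k) := by
  have h' : ∃ p : Ordinal.{u} × ℕ, IsBoundary e L p.1 p.2 := ⟨(N, k), h⟩
  rw [boundary, dif_pos h']
  have := h'.choose_spec.unique h
  exact Prod.ext this.1 this.2

/-! ### A colouring of the double successor in countably many colours -/

theorem exists_max_list {L : List Ordinal.{u}} (hL : L ≠ []) : ∃ M ∈ L, ∀ y ∈ L, y ≤ M := by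
  obtain ⟨M, hM, h⟩ := Set.exists_max_image {x | x ∈ L} id L.finite_toSet
    (List.exists_mem_of_ne_nil L hL)
  exact ⟨M, hM, h⟩

/-- The cardinality of an ordinal below `θ` is separated from `θ` by a regular cardinal, also when
`θ` is singular. -/
theorem exists_isRegular_between {th : Cardinal.{u}} (hth : ℵ₀ ≤ th) {η : Ordinal.{u}}
    (hη : η < th.ord) : ∃ τ : Cardinal.{u}, τ.IsRegular ∧ η.card < τ ∧ τ ≤ th := by
  rcases lt_or_ge η.card ℵ₀ with h | h
  · exact ⟨ℵ₀, isRegular_aleph0, h, hth⟩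
  · exact ⟨Order.succ η.card, isRegular_succ h, Order.lt_succ _,
      Order.succ_le_of_lt (Cardinal.lt_ord.1 hη)⟩

/-- An unbounded subset of `θ⁺` has `θ` many elements below some bound. -/
theorem exists_le_mk_initial {th : Cardinal.{u}} (hth : ℵ₀ ≤ th) {X : Set Ordinal.{u}}
    (hX : ∀ b < (Order.succ th).ord, ∃ x ∈ X, b < x ∧ x < (Order.succ th).ord) :
    ∃ j < (Order.succ th).ord, Cardinal.lift.{u + 1} th ≤ #{x ∈ X | x < j} := by
  have hc := isRegular_succ hth
  have h1 : Cardinal.lift.{u + 1} th ≤ #{x ∈ X | x < (Order.succ th).ord} := by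
    by_contra! h
    obtain ⟨b, hb, h1⟩ := exists_bound_set (δ := (Order.succ th).ord)
      (s := {x ∈ X | x < (Order.succ th).ord}) (by
        rw [hc.cof_ord]; exact h.trans (Cardinal.lift_lt.2 (Order.lt_succ th))) id
      (fun x hx => hx.2)
    obtain ⟨x, hx, h2, h3⟩ := hX b hb
    exact (h1 x ⟨hx, h3⟩).not_gt h2
  obtain ⟨Y, hY, hYc⟩ := Cardinal.le_mk_iff_exists_subset.1 h1
  obtain ⟨j, hj, h2⟩ := exists_bound_set (δ := (Order.succ th).ord) (s := Y) (by
    rw [hc.cof_ord, hYc, Cardinal.lift_lt]; exact Order.lt_succ th) id (fun x hx => (hY hx).2)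
  exact ⟨j, hj, hYc ▸ Cardinal.mk_le_mk_of_subset fun x hx => ⟨(hY hx).1, h2 x hx⟩⟩

/-- A finite list of ordinals below an infinite cardinal is bounded; the cofinality of the cardinal
plays no role. -/
theorem exists_bound_list_ord {th : Cardinal.{u}} (hth : ℵ₀ ≤ th) (L : List Ordinal.{u})
    (f : Ordinal.{u} → Ordinal.{u}) (P : Ordinal.{u} → Prop)
    (hf : ∀ x ∈ L, P x → f x < th.ord) : ∃ b < th.ord, ∀ x ∈ L, P x → f x < b := by
  classical
  obtain ⟨b, hb, h⟩ := exists_bound_list (δ := th.ord)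
    (Ordinal.aleph0_le_cof_iff.2 (Ordinal.one_lt_cof_iff.2 (Cardinal.isSuccLimit_ord hth)))
    (L.filter (P ·)) f
    (fun x hx => by
      rw [List.mem_filter] at hx
      exact hf x hx.1 (by simpa using hx.2))
  exact ⟨b, hb, fun x hx hP => h x (List.mem_filter.2 ⟨hx, by simpa using hP⟩)⟩

/-- For every `i < κ`, from some ordinal on, walks starting at suitable values of `F` have a point
of weight at least `i`. -/
theorem exists_le_weight_mem_trace {ka : Cardinal.{u}} (hka : ka.IsRegular)
    {F : Ordinal.{u} → Ordinal.{u}}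
    (hF : ∀ p < (Order.succ ka).ord, p < F p ∧ F p < (Order.succ ka).ord) {i : Ordinal.{u}}
    (hi : i < ka.ord) : ∃ c < (Order.succ ka).ord, ∀ α < (Order.succ ka).ord, c ≤ α →
      ∃ p < (Order.succ ka).ord, α < p ∧ ∃ x ∈ trace (F p) α, i ≤ weight x α := by
  have h1 : ∀ p : Ordinal.{u}, p.cof = ka → ∃ b < p, ∀ α, b ≤ α → α < p → i ≤ weight p α :=
    fun p hp => exists_le_weight (by rwa [hp])
  choose! R hR hRw using h1
  obtain ⟨c, hc, h2⟩ := (isStat_cof hka).exists_mem_trace hka (fun p hp => hp) hF R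
    (fun p hp => hR p hp)
  refine ⟨c, hc, fun α hα hcα => ?_⟩
  obtain ⟨p, hp, hp', hαp, hRα, hpt⟩ := h2 α hα hcα
  exact ⟨p, hp', hαp, p, hpt, hRw p hp α hRα hαp⟩

/-- The point on the walk from `M` to `N` that sits at the boundary position of the weights. -/
noncomputable def weightBoundary (e : Ordinal.{u} → Ordinal.{u} → Ordinal.{u})
    (N M : Ordinal.{u}) : Ordinal.{u} :=
  (trace M N).getD (boundary e ((trace M N).map (weight · N))).2 0

/-- There is a colouring of `[θ⁺⁺]²` with countably many colours that takes every colour at some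
pair `N < F l` with `N < l` and `N` in `A`, for every unbounded set `A` and every
progressive `F`. -/
theorem exists_colouring_nat {th : Cardinal.{u}} (hth : ℵ₀ ≤ th) :
    ∃ c : Ordinal.{u} → Ordinal.{u} → ℕ, ∀ (A : Set Ordinal.{u}) (F : Ordinal.{u} → Ordinal.{u}),
      (∀ b < (Order.succ (Order.succ th)).ord, ∃ N ∈ A, b < N ∧
        N < (Order.succ (Order.succ th)).ord) →
      (∀ l < (Order.succ (Order.succ th)).ord, l < F l ∧
        F l < (Order.succ (Order.succ th)).ord) →
      ∀ r : ℕ, ∃ l < (Order.succ (Order.succ th)).ord, ∃ N ∈ A, N < l ∧ c N (F l) = r := by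
  have hka : (Order.succ th).IsRegular := isRegular_succ hth
  have hmu : (Order.succ (Order.succ th)).IsRegular := isRegular_succ hka.1
  have hkamu : Order.succ th < Order.succ (Order.succ th) := Order.lt_succ _
  have hthka : th < Order.succ th := Order.lt_succ _
  obtain ⟨e, he1, he2, he3⟩ := exists_transitive th
  obtain ⟨h0, hh0⟩ := (isStat_cof hka).exists_partition hka (K := ℕ) (by
    rw [Cardinal.mk_nat, Cardinal.lift_aleph0, Cardinal.lift_uzero]
    exact hmu.1)
  refine ⟨fun N M => h0 (weightBoundary e N M), fun A F hA hF r => ?_⟩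
  set ka := Order.succ th with hkadef
  set mu := Order.succ ka with hmudef
  -- all constants `c i` are bounded by a limit `m` of `A` in the fibre of `r`
  have h1 : ∀ i < ka.ord, ∃ c < mu.ord, ∀ α < mu.ord, c ≤ α →
      ∃ p < mu.ord, α < p ∧ ∃ x ∈ trace (F p) α, i ≤ weight x α := fun i hi =>
    exists_le_weight_mem_trace hka hF hi
  choose! c hc hcw using h1
  obtain ⟨cc, hcc, hcc'⟩ := exists_bound_lt (δ := mu.ord) (τ := ka.ord)
    (by rw [hmu.cof_ord, Cardinal.card_ord]; exact hkamu) c hc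
  choose! nx hnx using hA
  obtain ⟨m, ⟨hmcof, hmr⟩, hmmu, hmcc, hmnx, -⟩ := (hh0 r).exists_gt hmu.1 nx
    (fun b hb => (hnx b hb).2.2) hcc
  have hmcof : m.cof = ka := hmcof
  -- the walks to `m` from above
  have h3 : ∀ i < ka.ord, ∃ p N b η, (p < mu.ord ∧ m < p ∧
      N ∈ (trace (F p) m).map (weight · m) ∧ (∀ y ∈ (trace (F p) m).map (weight · m), y ≤ N) ∧
      i ≤ N ∧ N < ka.ord) ∧
      (b < m ∧ ∀ α, b ≤ α → α < m → trace (F p) α = trace (F p) m ++ trace m α ∧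
        ∀ x ∈ trace (F p) m, weight x α = weight x m) ∧
      η < th.ord ∧ ∀ y ∈ (trace (F p) m).map (weight · m), y < N → e y N < η := by
    intro i hi
    obtain ⟨p, hp, hmp, x, hx, hix⟩ := hcw i hi m hmmu ((hcc' i hi).trans hmcc).le
    obtain ⟨N, hN, hmax⟩ := exists_max_list (L := (trace (F p) m).map (weight · m))
      (List.ne_nil_of_mem (List.mem_map_of_mem hx))
    obtain ⟨b, hb, hb'⟩ := exists_trace_eq_append hmcof (hmp.trans (hF p hp).1) (hF p hp).2
    have hNka : N < ka.ord := by
      obtain ⟨y, hy, rfl⟩ := List.mem_map.1 hN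
      refine (weight_spec (mem_trace hy).1).1.trans_le (Cardinal.ord_le_ord.2 ?_)
      refine (cof_le_card y).trans (Order.lt_succ_iff.1 (Cardinal.lt_ord.1 ?_))
      exact (mem_trace hy).2.trans_lt (hF p hp).2
    obtain ⟨η, hη, hη'⟩ := exists_bound_list_ord hth ((trace (F p) m).map (weight · m))
      (fun y => e y N) (fun y => y < N) (fun y _ hyN => he1 N hNka y hyN)
    exact ⟨p, N, b, η, ⟨hp, hmp, hN, hmax, hix.trans (hmax _ (List.mem_map_of_mem hx)), hNka⟩,
      ⟨hb, hb'⟩, hη, hη'⟩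
  choose! p N b η h3 using h3
  -- uniformize the bounds `η i`
  obtain ⟨η', hη', hst⟩ := (isStat_univ hka (hth.trans_lt hthka)).exists_fiber_ord hka
    (Cardinal.ord_lt_ord.2 hthka) η (fun i _ hi => (h3 i hi).2.2.1)
  have hI : ∀ b < ka.ord, ∃ i, b < i ∧ i < ka.ord ∧ η i = η' := by
    intro b hb
    obtain ⟨i, ⟨-, hi⟩, hi', hbi⟩ := hst.exists_mem_gt hka.1 hb
    exact ⟨i, hbi, hi', hi⟩
  -- `j` lies above `θ` many of the top weights, more than the sublevel sets of `e` can contain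
  obtain ⟨j, hj, hjc⟩ := exists_le_mk_initial hth (X := {x | ∃ i < ka.ord, η i = η' ∧ N i = x})
    (by
      intro b hb
      obtain ⟨i, h4, h5, h6⟩ := hI b hb
      exact ⟨N i, ⟨i, h5, h6, rfl⟩, h4.trans_le (h3 i h5).1.2.2.2.2.1, (h3 i h5).1.2.2.2.2.2⟩)
  -- an element `ν` of `A` close to `m`
  obtain ⟨bb, hbb, hbb'⟩ := exists_bound_lt (δ := m) (τ := j)
    (by rw [hmcof]; exact Cardinal.lt_ord.1 hj) b (fun i hi => (h3 i (hi.trans hj)).2.1.1)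
  obtain ⟨b', hb', hw⟩ := exists_le_weight (x := m) (i := j) (by rwa [hmcof])
  obtain ⟨ν, hν, hνm, hνb, hνb'⟩ : ∃ ν ∈ A, ν < m ∧ bb < ν ∧ b' ≤ ν := by
    have hmax := max_lt hbb hb'
    obtain ⟨h4, h5, -⟩ := hnx _ (hmax.trans hmmu)
    exact ⟨_, h4, hmnx _ hmax, (le_max_left _ _).trans_lt h5, ((le_max_right _ _).trans_lt h5).le⟩
  have hjν := hw ν hνb' hνm
  obtain ⟨M, hM, hMmax⟩ := exists_max_list (L := (trace m ν).map (weight · ν))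
    (by rw [trace_of_lt hνm]; simp)
  have hMka : M < ka.ord := by
    obtain ⟨y, hy, rfl⟩ := List.mem_map.1 hM
    refine (weight_spec (mem_trace hy).1).1.trans_le (Cardinal.ord_le_ord.2 ?_)
    refine (cof_le_card y).trans (Order.lt_succ_iff.1 (Cardinal.lt_ord.1 ?_))
    exact (mem_trace hy).2.trans_lt hmmu
  have hjM : j ≤ M := hjν.trans (hMmax _ (by rw [trace_of_lt hνm]; simp))
  obtain ⟨ζ, hζ, hζ'⟩ := exists_bound_list_ord hth ((trace m ν).map (weight · ν))
    (fun y => e y M) (fun y => y < M) (fun y _ hyM => he1 M hMka y hyM)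
  -- a top weight of the upper walk that is far from `M`
  obtain ⟨i, hi, hiη, hij, hie⟩ : ∃ i < ka.ord, η i = η' ∧ N i < j ∧ max ζ η' < e (N i) M := by
    by_contra! hcon
    obtain ⟨τ, hτ, hτ1, hτ2⟩ := exists_isRegular_between hth (max_lt hζ hη')
    have := he3 M hMka (max ζ η') τ hτ hτ1
    refine absurd (hjc.trans (Cardinal.mk_le_mk_of_subset ?_))
      (this.trans_le (Cardinal.lift_le.2 hτ2)).not_ge
    rintro _ ⟨⟨i, hi, hiη, rfl⟩, hij⟩
    exact ⟨hij.trans_le hjM, hcon i hi hiη hij⟩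
  obtain ⟨⟨hpmu, hmp, hN, hNmax, hiN, hNka⟩, ⟨-, hsplit⟩, -, hηi⟩ := h3 i hi
  have hbν : b i ≤ ν := ((hbb' i (hiN.trans_lt hij)).trans hνb).le
  obtain ⟨htr, hwt⟩ := hsplit ν hbν hνm
  refine ⟨p i, hpmu, ν, hν, hνm.trans hmp, ?_⟩
  have hlab : (trace (F (p i)) ν).map (weight · ν) = (trace (F (p i)) m).map (weight · m) ++
      ([] ++ weight m ν :: (trace (walkStep m ν) ν).map (weight · ν)) := by
    rw [htr, List.map_append, List.map_congr_left (g := (weight · m)) hwt, trace_of_lt hνm]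
    rfl
  have hϱ : (trace m ν).map (weight · ν) =
      [] ++ weight m ν :: (trace (walkStep m ν) ν).map (weight · ν) := by
    rw [trace_of_lt hνm]; rfl
  rw [hϱ] at hM hMmax hζ'
  have hbd := isBoundary_append (e := e) hN hNmax (τ := []) (by simp) (hij.trans_le hjν) hM hMmax
    (fun y hy hyM => (hζ' y hy hyM).trans ((le_max_left _ _).trans_lt hie))
    (fun y hy hyN => by
      refine (he2 M hMka (N i) (hij.trans_le hjM) y hyN).trans (max_le ?_ le_rfl)
      exact (hηi y hy hyN).le.trans (hiη ▸ (le_max_right _ _).trans hie.le))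
  rw [← hlab] at hbd
  change h0 (weightBoundary e ν (F (p i))) = r
  rw [weightBoundary, hbd.boundary_eq, ← hmr, htr]
  congr 1
  rw [trace_of_lt hνm]
  simp

/-! ### A colouring of the successor of a regular cardinal for small sets -/

/-- A list with an entry `j` splits at its first entry that is at least `j`. -/
theorem exists_eq_append_cons_ge {L : List Ordinal.{u}} {j : Ordinal.{u}} (hj : j ∈ L) :
    ∃ τ j' σ, L = τ ++ j' :: σ ∧ j ≤ j' ∧ ∀ y ∈ τ, y < j := by
  induction L with
  | nil => simp at hj
  | cons a L ih =>
    rcases le_or_gt j a with h | h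
    · exact ⟨[], a, L, rfl, h, by simp⟩
    · obtain ⟨τ, j', σ, rfl, h1, h2⟩ := ih (by
        rcases List.mem_cons.1 hj with rfl | hj
        · exact absurd h (lt_irrefl _)
        · exact hj)
      refine ⟨a :: τ, j', σ, rfl, h1, fun y hy => ?_⟩
      rcases List.mem_cons.1 hy with rfl | hy
      · exact h
      · exact h2 y hy

section SmallSets

variable {ka mu d : Cardinal.{u}}

/-- On a stationary set of `δ`, the walks starting in `U δ` pass through `δ`, and the labels met
before `δ` are bounded, both uniformly. -/
theorem exists_uniform_walk (hd : d.IsRegular) (hmu : mu.IsRegular) (hkamu : ka < mu)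
    (hmud : mu ≤ d) {g : Ordinal.{u} → Ordinal.{u}} (hg : ∀ x, g x < mu.ord)
    {U : Ordinal.{u} → Set Ordinal.{u}}
    (hU : ∀ δ < (Order.succ d).ord, #(U δ) < Cardinal.lift.{u + 1} ka)
    (hU' : ∀ δ < (Order.succ d).ord, ∀ β ∈ U δ, δ < β ∧ β < (Order.succ d).ord) :
    ∃ c < (Order.succ d).ord, ∃ ξ < mu.ord, ∃ T, IsStat (Order.succ d) T ∧
      ∀ δ ∈ T, ∀ β ∈ U δ, ∀ α, c ≤ α → α < δ →
        trace β α = trace β δ ++ trace δ α ∧ ∀ x ∈ trace β δ, g x < ξ := by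
  have hlam : (Order.succ d).IsRegular := isRegular_succ hd.1
  have h1 : ∀ δ, δ.cof = d ∧ δ < (Order.succ d).ord → ∃ b ξ, b < δ ∧ ξ < mu.ord ∧ ∀ β ∈ U δ,
      ∀ α, b ≤ α → α < δ → trace β α = trace β δ ++ trace δ α ∧ ∀ x ∈ trace β δ, g x < ξ := by
    rintro δ ⟨hδ, hδ'⟩
    have h2 : ∀ β ∈ U δ, ∃ b < δ, ∀ α, b ≤ α → α < δ →
        trace β α = trace β δ ++ trace δ α ∧ ∀ x ∈ trace β δ, weight x α = weight x δ :=
      fun β hβ => exists_trace_eq_append hδ (hU' δ hδ' β hβ).1 (hU' δ hδ' β hβ).2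
    choose! b hb hb' using h2
    have h3 : ∀ β ∈ U δ, ∃ ξ < mu.ord, ∀ x ∈ trace β δ, g x < ξ := fun β _ =>
      exists_bound_list (by rw [hmu.cof_ord]; exact hmu.1) _ g (fun x _ => hg x)
    choose! ξ hξ hξ' using h3
    obtain ⟨b', hb1, hb2⟩ := exists_bound_set (δ := δ) (s := U δ) (by
      rw [hδ]; exact (hU δ hδ').trans (Cardinal.lift_lt.2 (hkamu.trans_le hmud))) b hb
    obtain ⟨ξ', hξ1, hξ2⟩ := exists_bound_set (δ := mu.ord) (s := U δ) (by
      rw [hmu.cof_ord]; exact (hU δ hδ').trans (Cardinal.lift_lt.2 hkamu)) ξ hξ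
    exact ⟨b', ξ', hb1, hξ1, fun β hβ α h4 h5 =>
      ⟨(hb' β hβ α ((hb2 β hβ).le.trans h4) h5).1, fun x hx => (hξ' β hβ x hx).trans (hξ2 β hβ)⟩⟩
  choose! b ξ hb hξ hbξ using h1
  obtain ⟨c, hc, h2⟩ := ((isStat_cof hd).mono (B := {δ | δ.cof = d ∧ δ < (Order.succ d).ord})
    fun x hx hx' => ⟨hx, hx'⟩).exists_const hlam b (fun δ hδ _ _ => hb δ hδ)
  obtain ⟨ξ', hξ', h3⟩ := h2.exists_fiber_ord hlam
    (Cardinal.ord_lt_ord.2 (hmud.trans_lt (Order.lt_succ d))) ξ (fun δ hδ _ => hξ δ hδ.1)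
  refine ⟨c, hc, ξ', hξ', _, h3, fun δ hδ β hβ α h4 h5 => ?_⟩
  have := hbξ δ hδ.1.1 β hβ α (hδ.1.2 ▸ h4) h5
  exact ⟨this.1, hδ.2 ▸ this.2⟩

/-- The lower half of the colouring argument. Below `m` there is a `ν` such that the labels on all
walks from `m` into `V ν` start with the same segment `τ ++ [j']`, where `j'` is the first entry
that is at least `j`; and every `N < j` beyond the bound `t` dominates those labels as seen
from their maximum. -/
theorem exists_uniform_labels (hka : ka.IsRegular)
    {g : Ordinal.{u} → Ordinal.{u}} (hg : ∀ x, g x < mu.ord)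
    {e : Ordinal.{u} → Ordinal.{u} → Ordinal.{u}}
    (he1 : ∀ γ < mu.ord, ∀ α < γ, e α γ < ka.ord)
    (he3 : ∀ γ < mu.ord, ∀ η < ka.ord, #{α | α < γ ∧ e α γ ≤ η} < Cardinal.lift.{u + 1} ka)
    {V : Ordinal.{u} → Set Ordinal.{u}} {G : Ordinal.{u} → Ordinal.{u}} {m : Ordinal.{u}}
    (hm : m < (Order.succ d).ord)
    (hV : ∀ ν < m, #(V ν) < Cardinal.lift.{u + 1} ka) (hV' : ∀ ν < m, ∀ α ∈ V ν, ν < α)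
    (hm' : ∀ j < mu.ord, ∀ b < m, ∃ n < m, b < n ∧ n.cof = d ∧ g n = j ∧
      ∀ ν < n, G ν < n ∧ ∀ x ∈ V ν, x < n)
    {η : Ordinal.{u}} (hη : η < ka.ord) {j : Ordinal.{u}} (hj : j < mu.ord) (hjc : j.cof = ka)
    {b : Ordinal.{u}} (hb : b < m) :
    ∃ ν τ j' t, b ≤ ν ∧ ν < m ∧ G ν < m ∧ j ≤ j' ∧ j' < mu.ord ∧ t < j ∧ (∀ y ∈ τ, y < t) ∧
      ∀ α ∈ V ν, α < m ∧ ∃ σ M, (trace m α).map g = τ ++ j' :: σ ∧ M ∈ τ ++ j' :: σ ∧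
        (∀ y ∈ τ ++ j' :: σ, y ≤ M) ∧ ∀ N, t ≤ N → N < j → η < e N M ∧
          ∀ y ∈ τ ++ j' :: σ, y < M → e y M < e N M := by
  obtain ⟨n, hnm, hbn, hnd, hnj, hcl⟩ := hm' j hj b hb
  obtain ⟨bn, hbn', hsplit⟩ := exists_trace_eq_append hnd hnm hm
  have hνn : max b bn < n := max_lt hbn hbn'
  have hνm := hνn.trans hnm
  set ν := max b bn
  obtain ⟨τ, j', σ₀, hΛ, hjj', hτ⟩ := exists_eq_append_cons_ge
    (L := (trace m n).map g ++ [j]) (j := j) (by simp)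
  have hj' : j' < mu.ord := by
    have h1 : j' ∈ (trace m n).map g ++ [j] := by rw [hΛ]; simp
    rcases List.mem_append.1 h1 with h2 | h2
    · obtain ⟨x, -, rfl⟩ := List.mem_map.1 h2
      exact hg x
    · rwa [List.mem_singleton.1 h2]
  have h1 : ∀ α ∈ V ν, ∃ σ M ζ, (trace m α).map g = τ ++ j' :: σ ∧ M ∈ τ ++ j' :: σ ∧
      (∀ y ∈ τ ++ j' :: σ, y ≤ M) ∧ M < mu.ord ∧ ζ < ka.ord ∧
      ∀ y ∈ τ ++ j' :: σ, y < M → e y M < ζ := by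
    intro α hα
    have hαn := (hcl ν hνn).2 α hα
    have hνα := hV' ν hνm α hα
    have htr := (hsplit α ((le_max_right _ _).trans hνα.le) hαn).1
    have hlab : (trace m α).map g = τ ++ j' :: (σ₀ ++ (trace (walkStep n α) α).map g) := by
      rw [← List.cons_append, ← List.append_assoc, ← hΛ, htr, trace_of_lt hαn, ← hnj]
      simp
    obtain ⟨M, hM, hM'⟩ := exists_max_list
      (L := τ ++ j' :: (σ₀ ++ (trace (walkStep n α) α).map g)) (by simp)
    have hMmu : M < mu.ord := by
      rw [← hlab] at hM
      obtain ⟨x, -, rfl⟩ := List.mem_map.1 hM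
      exact hg x
    obtain ⟨ζ, hζ, hζ'⟩ := exists_bound_list_ord hka.1
      (τ ++ j' :: (σ₀ ++ (trace (walkStep n α) α).map g)) (fun y => e y M) (fun y => y < M)
      (fun y _ hy => he1 M hMmu y hy)
    exact ⟨_, M, ζ, hlab, hM, hM', hMmu, hζ, hζ'⟩
  choose! σ M ζ h1 using h1
  have hVν := hV ν hνm
  obtain ⟨ζ', hζ', hζζ'⟩ := exists_bound_set (δ := ka.ord) (s := V ν) (by rwa [hka.cof_ord]) ζ
    (fun α hα => (h1 α hα).2.2.2.2.1)
  have hmax : max ζ' η < ka.ord := max_lt hζ' hη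
  -- the `N` that are too close to one of the maxima
  have hbad : #(⋃ α ∈ V ν, {N | N < M α ∧ e N (M α) ≤ max ζ' η}) < Cardinal.lift.{u + 1} ka :=
    (Cardinal.card_biUnion_lt_iff_forall_of_isRegular hka.lift hVν).2
      fun α hα => he3 _ (h1 α hα).2.2.2.1 _ hmax
  obtain ⟨t1, ht1, ht1'⟩ := exists_bound_set (δ := j)
    (s := {N | N ∈ (⋃ α ∈ V ν, {N | N < M α ∧ e N (M α) ≤ max ζ' η}) ∧ N < j})
    (by rw [hjc]; exact (Cardinal.mk_le_mk_of_subset fun N hN => hN.1).trans_lt hbad)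
    id (fun N hN => hN.2)
  obtain ⟨t0, ht0, ht0'⟩ := exists_bound_list (δ := j) (by rw [hjc]; exact hka.1) τ id hτ
  refine ⟨ν, τ, j', max t0 t1, le_max_left _ _, hνm, ((hcl ν hνn).1).trans hnm, hjj', hj',
    max_lt ht0 ht1, fun y hy => (ht0' y hy).trans_le (le_max_left _ _), fun α hα =>
    ⟨((hcl ν hνn).2 α hα).trans hnm, σ α, M α, (h1 α hα).1, (h1 α hα).2.1, (h1 α hα).2.2.1,
    fun N hN hNj => ?_⟩⟩
  have hjM : j' ≤ M α := (h1 α hα).2.2.1 j' (by simp)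
  have h2 : max ζ' η < e N (M α) := by
    by_contra! h
    refine (ht1' N ⟨Set.mem_biUnion hα ⟨hNj.trans_le (hjj'.trans hjM), h⟩, hNj⟩).not_ge ?_
    exact (le_max_right _ _).trans hN
  refine ⟨(le_max_right _ _).trans_lt h2, fun y hy hyM => ?_⟩
  exact ((h1 α hα).2.2.2.2.2 y hy hyM).trans ((hζζ' α hα).trans ((le_max_left _ _).trans_lt h2))

/-- The point of the walk from `β` to `α` that lies `c N y` many steps before the boundary position
of the labels `g`, where `N` is the pivot and `y` the label at the boundary. -/
noncomputable def labelBoundary (c : Ordinal.{u} → Ordinal.{u} → ℕ)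
    (e : Ordinal.{u} → Ordinal.{u} → Ordinal.{u}) (g : Ordinal.{u} → Ordinal.{u})
    (α β : Ordinal.{u}) : Ordinal.{u} :=
  let b := boundary e ((trace β α).map g)
  (trace β α).getD (b.2 - c b.1 (((trace β α).map g).getD b.2 0)) 0

/-- If the walk consists of `P`, `m` and `Q`, and the labels from `m` on start with `τ ++ [j]`
where `j` sits at the boundary, then `labelBoundary` finds `m` as soon as `c` guesses the length
of `τ`. -/
theorem labelBoundary_eq {c : Ordinal.{u} → Ordinal.{u} → ℕ}
    {e : Ordinal.{u} → Ordinal.{u} → Ordinal.{u}} {g : Ordinal.{u} → Ordinal.{u}}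
    {α β m N j : Ordinal.{u}} {P Q : List Ordinal.{u}} {τ σ : List Ordinal.{u}}
    (htr : trace β α = P ++ m :: Q) (hQ : (m :: Q).map g = τ ++ j :: σ)
    (hb : IsBoundary e (P.map g ++ (τ ++ j :: σ)) N ((P.map g).length + τ.length))
    (hc : c N j = τ.length) : labelBoundary c e g α β = m := by
  have hlab : (trace β α).map g = P.map g ++ (τ ++ j :: σ) := by
    rw [htr, List.map_append, hQ]
  rw [labelBoundary, hlab, hb.boundary_eq]
  dsimp only
  have h1 : (P.map g ++ (τ ++ j :: σ)).getD ((P.map g).length + τ.length) 0 = j := by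
    rw [← List.append_assoc, ← List.length_append]
    simp
  rw [h1, hc, htr]
  simp

/-- There is a colouring of `[∂⁺]²` that takes every colour `k` constantly on the rectangle formed
by `V ν` and `U δ`, for suitable `ν < δ`, whenever `V ν` and `U ν` are sets of at most `θ`
ordinals above `ν`. The function `G` serves to keep `δ` above further data depending on `ν`. -/
theorem exists_colouring_small_sets {th : Cardinal.{u}} (hth : ℵ₀ ≤ th) (hd : d.IsRegular)
    (hthd : Order.succ th < d) {K : Type v} [Nonempty K]
    (hK : Cardinal.lift.{u} #K ≤ Cardinal.lift.{v} (Order.succ d)) :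
    ∃ c : Ordinal.{u} → Ordinal.{u} → K, ∀ V U : Ordinal.{u} → Set Ordinal.{u},
      (∀ ν < (Order.succ d).ord, #(V ν) ≤ Cardinal.lift.{u + 1} th) →
      (∀ ν < (Order.succ d).ord, ∀ x ∈ V ν, ν < x ∧ x < (Order.succ d).ord) →
      (∀ ν < (Order.succ d).ord, #(U ν) ≤ Cardinal.lift.{u + 1} th) →
      (∀ ν < (Order.succ d).ord, ∀ x ∈ U ν, ν < x ∧ x < (Order.succ d).ord) →
      ∀ G : Ordinal.{u} → Ordinal.{u}, (∀ ν < (Order.succ d).ord, G ν < (Order.succ d).ord) →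
      ∀ k : K, ∃ ν δ, δ < (Order.succ d).ord ∧ ν < δ ∧ G ν < δ ∧
        ∀ x ∈ V ν, ∀ y ∈ U δ, x < y ∧ c x y = k := by
  have hlam : (Order.succ d).IsRegular := isRegular_succ hd.1
  have hka : (Order.succ th).IsRegular := isRegular_succ hth
  have hmu : (Order.succ (Order.succ th)).IsRegular := isRegular_succ hka.1
  have hkamu : Order.succ th < Order.succ (Order.succ th) := Order.lt_succ _
  have hthka : th < Order.succ th := Order.lt_succ _
  have hmud : Order.succ (Order.succ th) ≤ d := Order.succ_le_of_lt hthd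
  have hdlam : d < Order.succ d := Order.lt_succ d
  obtain ⟨c0, hc0⟩ := exists_colouring_nat hth
  obtain ⟨e, he1, he2, he3⟩ := exists_transitive (Order.succ th)
  set ka := Order.succ th with hkadef
  set mu := Order.succ ka with hmudef
  set lam := Order.succ d with hlamdef
  have : Nonempty (Set.Iio mu.ord) := ⟨⟨0, hmu.ord_pos⟩⟩
  -- one partition for the colours `k`, one for the labels
  obtain ⟨h, hh⟩ := (isStat_cof hd).exists_partition hd hK
  obtain ⟨g', hg'⟩ := (isStat_cof hd).exists_partition hd (K := Set.Iio mu.ord) (by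
    rw [Cardinal.mk_Iio_ordinal, Cardinal.card_ord, Cardinal.lift_lift, Cardinal.lift_le]
    exact hmud.trans hdlam.le)
  let g : Ordinal.{u} → Ordinal.{u} := fun x => (g' x).1
  have hg : ∀ x, g x < mu.ord := fun x => (g' x).2
  have hgs : ∀ i < mu.ord, IsStat lam {δ : Ordinal.{u} | δ.cof = d ∧ g δ = i} := fun i hi =>
    (hg' ⟨i, hi⟩).mono fun x hx _ => ⟨hx.1, congrArg Subtype.val hx.2⟩
  clear_value g
  refine ⟨fun α β => h (labelBoundary c0 e g α β), fun V U hV hV' hU hU' G hG k => ?_⟩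
  have hltka : ∀ {x : Cardinal.{u + 1}}, x ≤ Cardinal.lift.{u + 1} th →
      x < Cardinal.lift.{u + 1} ka := fun hx => hx.trans_lt (Cardinal.lift_lt.2 hthka)
  obtain ⟨cs, hcs, ξ, hξ, T, hT, hTw⟩ := exists_uniform_walk hd hmu hkamu hmud hg
    (fun δ hδ => hltka (hU δ hδ)) hU'
  -- walks from `T` meeting every label
  have h1 : ∀ p < lam.ord, ∃ δ ∈ T, δ < lam.ord ∧ p < δ := fun p hp => hT.exists_mem_gt hlam.1 hp
  choose! F hFT hF1 hF2 using h1
  have h2 : ∀ i < mu.ord, ∃ c < lam.ord, ∀ α < lam.ord, c ≤ α → ∃ p, (p.cof = d ∧ g p = i) ∧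
      p < lam.ord ∧ α < p ∧ 0 ≤ α ∧ p ∈ trace (F p) α := fun i hi =>
    (hgs i hi).exists_mem_trace hd (fun p hp => hp.1) (fun p hp => ⟨hF2 p hp, hF1 p hp⟩)
      (fun _ => 0) (fun p hp => by
        have h3 : p.cof = d := hp.1
        rcases eq_or_ne p 0 with rfl | h4
        · rw [Ordinal.cof_zero] at h3
          exact absurd h3.symm hd.pos.ne'
        · exact pos_iff_ne_zero.2 h4)
  choose! c hc hcw using h2
  obtain ⟨cc, hcc, hcc'⟩ := exists_bound_lt (δ := lam.ord) (τ := mu.ord)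
    (by rw [hlam.cof_ord, Cardinal.card_ord]; exact hmud.trans_lt hdlam) c hc
  -- the closure conditions on `m`
  have h3 : ∀ ν < lam.ord, ∃ b < lam.ord, G ν < b ∧ ∀ x ∈ V ν, x < b := by
    intro ν hν
    obtain ⟨b, hb, hb'⟩ := exists_bound_set (δ := lam.ord) (s := V ν) (by
      rw [hlam.cof_ord]
      exact (hltka (hV ν hν)).trans (Cardinal.lift_lt.2 (hthd.trans hdlam))) id
      (fun x hx => (hV' ν hν x hx).2)
    have hl := Cardinal.isSuccLimit_ord hlam.1
    exact ⟨max b (G ν + 1), max_lt hb (hl.add_one_lt (hG ν hν)),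
      (lt_add_one _).trans_le (le_max_right _ _), fun x hx => (hb' x hx).trans_le (le_max_left _ _)⟩
  choose! Φ hΦ hΦG hΦV using h3
  have h4 : ∀ j < mu.ord, ∀ b < lam.ord, ∃ n < lam.ord, b < n ∧ n.cof = d ∧ g n = j ∧
      ∀ ν < n, G ν < n ∧ ∀ x ∈ V ν, x < n := by
    intro j hj b hb
    obtain ⟨n, hn, hn', hbn, hcl, -⟩ := (hgs j hj).exists_gt hlam.1 Φ hΦ hb
    exact ⟨n, hn', hbn, hn.1, hn.2, fun ν hν => ⟨(hΦG ν (hν.trans hn')).trans (hcl ν hν),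
      fun x hx => (hΦV ν (hν.trans hn') x hx).trans (hcl ν hν)⟩⟩
  choose! n hn hn' using h4
  have h5 : ∀ b < lam.ord, ∃ b' < lam.ord, ∀ j < mu.ord, n j b < b' := fun b hb =>
    exists_bound_lt (by rw [hlam.cof_ord, Cardinal.card_ord]; exact hmud.trans_lt hdlam)
      (fun j => n j b) (fun j hj => hn j hj b hb)
  choose! Ψ hΨ hΨn using h5
  obtain ⟨m, ⟨hmd, hmk⟩, hmlam, hmcc, hmΨ, -⟩ := (hh k).exists_gt hlam.1 Ψ hΨ (max_lt hcc hcs)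
  have hmd : m.cof = d := hmd
  have hm' : ∀ j < mu.ord, ∀ b < m, ∃ n < m, b < n ∧ n.cof = d ∧ g n = j ∧
      ∀ ν < n, G ν < n ∧ ∀ x ∈ V ν, x < n := fun j hj b hb =>
    ⟨n j b, (hΨn b (hb.trans hmlam) j hj).trans (hmΨ b hb), hn' j hj b (hb.trans hmlam)⟩
  have hcsm : cs < m := (le_max_right _ _).trans_lt hmcc
  -- the walks down to `m`
  have h6 : ∀ i < mu.ord, ∃ δ N b η, (δ ∈ T ∧ δ < lam.ord ∧ m < δ) ∧
      (N ∈ (trace δ m).map g ∧ (∀ y ∈ (trace δ m).map g, y ≤ N) ∧ i ≤ N ∧ N < mu.ord) ∧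
      (b < m ∧ ∀ α, b ≤ α → α < m → trace δ α = trace δ m ++ trace m α) ∧
      η < ka.ord ∧ ∀ β ∈ U δ, ∀ y ∈ (trace β m).map g, y < N → e y N < η := by
    intro i hi
    obtain ⟨p, ⟨-, hpi⟩, hp, hmp, -, hpt⟩ := hcw i hi m hmlam
      ((hcc' i hi).trans ((le_max_left _ _).trans_lt hmcc)).le
    have hmδ := hmp.trans (hF2 p hp)
    obtain ⟨N, hN, hmax⟩ := exists_max_list (L := (trace (F p) m).map g)
      (List.ne_nil_of_mem (List.mem_map_of_mem hpt))
    have hNmu : N < mu.ord := by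
      obtain ⟨x, -, rfl⟩ := List.mem_map.1 hN
      exact hg x
    obtain ⟨b, hb, hb'⟩ := exists_trace_eq_append hmd hmδ (hF1 p hp)
    have h7 : ∀ β ∈ U (F p), ∃ η < ka.ord, ∀ y ∈ (trace β m).map g, y < N → e y N < η :=
      fun β _ => exists_bound_list_ord hka.1 _ (fun y => e y N) (fun y => y < N)
        (fun y _ hy => he1 N hNmu y hy)
    choose! η hη hη' using h7
    obtain ⟨η', hη1, hη2⟩ := exists_bound_set (δ := ka.ord) (s := U (F p))
      (by rw [hka.cof_ord]; exact hltka (hU _ (hF1 p hp))) η hη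
    exact ⟨F p, N, b, η', ⟨hFT p hp, hF1 p hp, hmδ⟩,
      ⟨hN, hmax, hpi ▸ hmax _ (List.mem_map_of_mem hpt), hNmu⟩,
      ⟨hb, fun α h8 h9 => (hb' α h8 h9).1⟩, hη1,
      fun β hβ y hy hyN => (hη' β hβ y hy hyN).trans (hη2 β hβ)⟩
  choose! δ N b η h6 using h6
  obtain ⟨η', hη', hI⟩ := (isStat_univ hmu (hka.1.trans_lt hkamu)).exists_fiber_ord hmu
    (Cardinal.ord_lt_ord.2 hkamu) η (fun i _ hi => (h6 i hi).2.2.2.1)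
  -- the walks down from `m`
  have h7 : ∀ j, j.cof = ka ∧ j < mu.ord → ∃ ν τ j' t,
      ((∀ i < j, b i ≤ ν) ∧ cs ≤ ν) ∧ ν < m ∧ G ν < m ∧ j ≤ j' ∧ j' < mu.ord ∧ t < j ∧
      (∀ y ∈ τ, y < t) ∧
      ∀ α ∈ V ν, α < m ∧ ∃ σ M, (trace m α).map g = τ ++ j' :: σ ∧ M ∈ τ ++ j' :: σ ∧
        (∀ y ∈ τ ++ j' :: σ, y ≤ M) ∧ ∀ N, t ≤ N → N < j → η' < e N M ∧
          ∀ y ∈ τ ++ j' :: σ, y < M → e y M < e N M := by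
    rintro j ⟨hjc, hj⟩
    obtain ⟨b', hb1, hb2⟩ := exists_bound_lt (δ := m) (τ := j)
      (by rw [hmd]; exact (Cardinal.lt_ord.1 hj).trans_le hmud) b
      (fun i hi => (h6 i (hi.trans hj)).2.2.1.1)
    obtain ⟨ν, τ, j', t, hν, h⟩ := exists_uniform_labels hka hg he1
      (fun γ hγ η hη => he3 γ hγ η ka hka (Cardinal.lt_ord.1 hη)) hmlam
      (fun ν hν => hltka (hV ν (hν.trans hmlam))) (fun ν hν x hx => (hV' ν (hν.trans hmlam) x hx).1)
      hm' hη' hj hjc (max_lt hb1 hcsm)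
    exact ⟨ν, τ, j', t, ⟨fun i hi => (hb2 i hi).le.trans ((le_max_left _ _).trans hν),
      (le_max_right _ _).trans hν⟩, h⟩
  choose! ν τ j' t h7 using h7
  -- make the bound `t` and the length of `τ` independent of `j`
  obtain ⟨t', ht', hJ⟩ := ((isStat_cof hka).mono (B := {j | j.cof = ka ∧ j < mu.ord})
    fun x hx hx' => ⟨hx, hx'⟩).exists_const hmu t (fun j hj _ _ => (h7 j hj).2.2.2.2.2.1)
  obtain ⟨r, hJr⟩ := hJ.exists_fiber hmu (ι := ℕ)
    (by simpa using (hka.1.trans_lt hkamu)) (fun j => (τ j).length)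
  have h8 : ∀ l < mu.ord, ∃ j, (((j.cof = ka ∧ j < mu.ord) ∧ t j = t') ∧ (τ j).length = r) ∧
      j < mu.ord ∧ l < j := fun l hl => hJr.exists_mem_gt hmu.1 hl
  choose! J hJ1 hJ2 hJ3 using h8
  -- the colouring `c0` selects an upper and a lower part that fit together
  obtain ⟨l, hl, N', ⟨i, hi, hiη, htN, hξN, rfl⟩, hNl, hcl⟩ := hc0
    {x | ∃ i < mu.ord, η i = η' ∧ t' ≤ N i ∧ ξ ≤ N i ∧ N i = x} (fun l => j' (J l))
    (by
      intro a ha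
      obtain ⟨i, ⟨-, hi⟩, hi', hai⟩ := hI.exists_mem_gt hmu.1 (max_lt ha (max_lt ht' hξ))
      have hiN := (h6 i hi').2.1.2.2.1
      exact ⟨N i, ⟨i, hi', hi, ((le_max_left _ _).trans (le_max_right _ _)).trans
        (hai.le.trans hiN), ((le_max_right _ _).trans (le_max_right _ _)).trans
        (hai.le.trans hiN), rfl⟩, (le_max_left _ _).trans_lt (hai.trans_le hiN),
        (h6 i hi').2.1.2.2.2⟩)
    (fun l hl => ⟨(hJ3 l hl).trans_le (h7 _ (hJ1 l hl).1.1).2.2.2.1,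
      (h7 _ (hJ1 l hl).1.1).2.2.2.2.1⟩) r
  obtain ⟨⟨hjC, hjt⟩, hjr⟩ := hJ1 l hl
  have hNj : N i < J l := hNl.trans (hJ3 l hl)
  obtain ⟨⟨hνb, hνc⟩, hνm, hGν, hjj', hj'mu, -, hτt, hlow⟩ := h7 _ hjC
  obtain ⟨⟨hδT, hδlam, hmδ⟩, ⟨hN, hNmax, hiN, hNmu⟩, ⟨-, hsplit⟩, -, hηi⟩ := h6 i hi
  refine ⟨ν (J l), δ i, hδlam, hνm.trans hmδ, hGν.trans hmδ, fun x hx y hy => ?_⟩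
  obtain ⟨hxm, σ, M, hlab, hM, hMmax, hdom⟩ := hlow x hx
  have hνx := (hV' _ (hνm.trans hmlam) x hx).1
  refine ⟨hxm.trans (hmδ.trans (hU' _ hδlam y hy).1), ?_⟩
  obtain ⟨hη1, hdom⟩ := hdom (N i) (hjt ▸ htN) hNj
  have htr1 := (hTw _ hδT y hy x (hνc.trans hνx.le) (hxm.trans hmδ)).1
  obtain ⟨htr2, hgξ⟩ := hTw _ hδT y hy m hcsm.le hmδ
  rw [hsplit x ((hνb i (hiN.trans_lt hNj)).trans hνx.le) hxm, ← List.append_assoc, ← htr2,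
    trace_of_lt hxm] at htr1
  rw [trace_of_lt hxm] at hlab
  have hMmu : M < mu.ord := by
    rw [← hlab] at hM
    obtain ⟨x, -, rfl⟩ := List.mem_map.1 hM
    exact hg x
  have hNj' := hNj.trans_le hjj'
  have hjM : j' (J l) ≤ M := hMmax _ (by simp)
  -- for `z` above `m`, transitivity gives `e z M ≤ max (e z N) (e N M)`, and `e z N < η' < e N M`
  have hbd := isBoundary_append (e := e) (ρ := (trace y m).map g) (N := N i)
    (by rw [htr2, List.map_append]; exact List.mem_append_right _ hN)
    (fun z hz => by
      rw [htr2, List.map_append, List.mem_append] at hz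
      rcases hz with hz | hz
      · obtain ⟨w, hw, rfl⟩ := List.mem_map.1 hz
        exact (hgξ w hw).le.trans hξN
      · exact hNmax z hz)
    (fun z hz => ((hτt z hz).trans_le (hjt ▸ htN)).le) hNj' hM hMmax hdom
    (fun z hz hzN => (he2 M hMmu (N i) (hNj'.trans_le hjM) z hzN).trans
      (max_le ((hηi y hy z hz hzN).le.trans (hiη ▸ hη1.le)) le_rfl))
  change h (labelBoundary c0 e g x y) = k
  rw [labelBoundary_eq htr1 hlab hbd (hcl.trans hjr.symm), hmk]

end SmallSets

/-! ### Coding small families -/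

/-- A code for a colouring pattern on a family of length `a < θ`: points of `χ` separating the
members of the family (as subsets of `χ`), the traces of the members on these points, and the
colours to be assigned to pairs of members. -/
abbrev Code (th chi sig : Cardinal.{u}) : Type (u + 1) :=
  Σ a : Set.Iio th.ord,
    ((Set.Iio a.1 × Set.Iio a.1 → Set.Iio chi.ord) ×
      (Set.Iio a.1 → Set.Iio a.1 × Set.Iio a.1 → Prop)) ×
    (Set.Iio a.1 × Set.Iio a.1 → Set.Iio sig.ord)

/-- There are at most `χ` many possibilities for the separating points and the traces. -/
theorem mk_separators_le {th chi : Cardinal.{u}} (hth : ℵ₀ ≤ th) (hchi0 : ℵ₀ ≤ chi)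
    (hchi : chi = chi ^< th) {a : Ordinal.{u}} (ha : a < th.ord) :
    #((Set.Iio a × Set.Iio a → Set.Iio chi.ord) × (Set.Iio a → Set.Iio a × Set.Iio a → Prop)) ≤
      Cardinal.lift.{u + 1} chi := by
  have ha' : a.card < th := Cardinal.lt_ord.1 ha
  have hle : ∀ τ < th, chi ^ τ ≤ chi := fun τ hτ => (Cardinal.le_powerlt chi hτ).trans hchi.ge
  have haa := Cardinal.mul_lt_of_lt hth ha' ha'
  have haaa := Cardinal.mul_lt_of_lt hth haa ha'
  have h2 : (2 : Cardinal.{u}) ≤ chi := (Cardinal.ofNat_lt_aleph0 (n := 2)).le.trans hchi0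
  have h3 : #((Set.Iio a × Set.Iio a → Set.Iio chi.ord) ×
      (Set.Iio a → Set.Iio a × Set.Iio a → Prop)) = Cardinal.lift.{u + 1}
        (chi ^ (a.card * a.card) * 2 ^ (a.card * a.card * a.card)) := by
    simp only [Cardinal.mk_prod, Cardinal.mk_arrow, Cardinal.mk_Iio_ordinal, Cardinal.lift_id,
      Cardinal.card_ord, Cardinal.lift_mul, Cardinal.lift_power, Cardinal.power_mul,
      Cardinal.lift_two, Cardinal.mk_Prop, Cardinal.lift_id']
  rw [h3, Cardinal.lift_le]
  exact (mul_le_mul' (hle _ haa) ((Cardinal.power_le_power_right h2).trans (hle _ haaa))).trans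
    (Cardinal.mul_eq_self hchi0).le

theorem mk_code_le {th chi sig : Cardinal.{u}} (hth : ℵ₀ ≤ th) (hthchi : th ≤ chi)
    (hchi : chi = chi ^< th) (hchisig : chi ≤ sig) (hsig : sig = sig ^< th) :
    #(Code th chi sig) ≤ Cardinal.lift.{u + 1} sig := by
  have hchi0 := hth.trans hthchi
  have hsig0 : ℵ₀ ≤ Cardinal.lift.{u + 1} sig := Cardinal.aleph0_le_lift.2 (hchi0.trans hchisig)
  rw [Cardinal.mk_sigma]
  refine (Cardinal.sum_le_sum _ (fun _ => Cardinal.lift.{u + 1} sig) fun a => ?_).trans ?_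
  · rw [Cardinal.mk_prod, Cardinal.lift_id, Cardinal.lift_id]
    have ha' : a.1.card < th := Cardinal.lt_ord.1 a.2
    have h1 : #(Set.Iio a.1 × Set.Iio a.1 → Set.Iio sig.ord) ≤ Cardinal.lift.{u + 1} sig := by
      have h2 : #(Set.Iio a.1 × Set.Iio a.1 → Set.Iio sig.ord) =
          Cardinal.lift.{u + 1} (sig ^ (a.1.card * a.1.card)) := by
        simp only [Cardinal.mk_prod, Cardinal.mk_arrow, Cardinal.mk_Iio_ordinal, Cardinal.lift_id,
          Cardinal.card_ord, Cardinal.lift_mul, Cardinal.lift_power]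
      rw [h2, Cardinal.lift_le]
      exact (Cardinal.le_powerlt sig (Cardinal.mul_lt_of_lt hth ha' ha')).trans hsig.ge
    exact (mul_le_mul' ((mk_separators_le hth hchi0 hchi a.2).trans (Cardinal.lift_le.2 hchisig))
      h1).trans (Cardinal.mul_eq_self hsig0).le
  · rw [Cardinal.sum_const, Cardinal.lift_id, Cardinal.lift_id, Cardinal.mk_Iio_ordinal,
      Cardinal.card_ord]
    exact (mul_le_mul' (Cardinal.lift_le.2 (hthchi.trans hchisig)) le_rfl).trans
      (Cardinal.mul_eq_self hsig0).le

/-- Ordinals below `lam ≤ 2 ^ χ` can be represented by distinct subsets of `χ`. -/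
theorem exists_separating {chi lam : Cardinal.{u}} (h : lam ≤ 2 ^ chi) :
    ∃ r : Ordinal.{u} → Set (Set.Iio chi.ord), ∀ x < lam.ord, ∀ y < lam.ord, r x = r y → x = y := by
  have h1 : #(Set.Iio lam.ord) ≤ #(Set (Set.Iio chi.ord)) := by
    rw [Cardinal.mk_set, Cardinal.mk_Iio_ordinal, Cardinal.mk_Iio_ordinal, Cardinal.card_ord,
      Cardinal.card_ord, ← Cardinal.lift_two_power, Cardinal.lift_le]
    exact h
  obtain ⟨f⟩ := h1
  classical
  refine ⟨fun x => if hx : x < lam.ord then f ⟨x, hx⟩ else ∅, fun x hx y hy hxy => ?_⟩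
  simp only [hx, hy, dif_pos] at hxy
  exact congrArg Subtype.val (f.injective hxy)

/-- The colour that the code `k` gives to a pair of ordinals: their traces on the separating points
determine their positions in the family. -/
noncomputable def decode {th chi sig : Cardinal.{u}} (r : Ordinal.{u} → Set (Set.Iio chi.ord))
    (k : Code th chi sig) (x y : Ordinal.{u}) : Ordinal.{u} :=
  open Classical in
  if h : ∃ q : Set.Iio k.1.1 × Set.Iio k.1.1,
      k.2.1.2 q.1 = (fun p => k.2.1.1 p ∈ r x) ∧ k.2.1.2 q.2 = fun p => k.2.1.1 p ∈ r y
  then (k.2.2 h.choose).1 else 0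

theorem decode_lt {th chi sig : Cardinal.{u}} (hsig : sig ≠ 0)
    (r : Ordinal.{u} → Set (Set.Iio chi.ord)) (k : Code th chi sig) (x y : Ordinal.{u}) :
    decode r k x y < sig.ord := by
  rw [decode]
  split_ifs with h
  · exact (k.2.2 h.choose).2
  · rw [pos_iff_ne_zero]
    simpa using hsig

theorem decode_eq {th chi sig : Cardinal.{u}} {r : Ordinal.{u} → Set (Set.Iio chi.ord)}
    (k : Code th chi sig) (hk : Function.Injective k.2.1.2) {x y : Ordinal.{u}}
    {i i' : Set.Iio k.1.1} (hx : k.2.1.2 i = fun p => k.2.1.1 p ∈ r x)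
    (hy : k.2.1.2 i' = fun p => k.2.1.1 p ∈ r y) : decode r k x y = k.2.2 (i, i') := by
  have h : ∃ q : Set.Iio k.1.1 × Set.Iio k.1.1,
      k.2.1.2 q.1 = (fun p => k.2.1.1 p ∈ r x) ∧ k.2.1.2 q.2 = fun p => k.2.1.1 p ∈ r y :=
    ⟨(i, i'), hx, hy⟩
  rw [decode, dif_pos h]
  have h1 : h.choose = (i, i') :=
    Prod.ext_iff.2 ⟨hk (h.choose_spec.1.trans hx.symm), hk (h.choose_spec.2.trans hy.symm)⟩
  rw [h1]

/-- Among `λ` many families of `a` distinct ordinals each, stationarily many have the same separating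
points and traces. -/
theorem exists_stat_separated {th chi lam : Cardinal.{u}} (hth : ℵ₀ ≤ th) (hchi0 : ℵ₀ ≤ chi)
    (hchi : chi = chi ^< th) (hlam : lam.IsRegular) (hchilam : chi < lam)
    {r : Ordinal.{u} → Set (Set.Iio chi.ord)}
    (hr : ∀ x < lam.ord, ∀ y < lam.ord, r x = r y → x = y)
    {a : Ordinal.{u}} (ha : a < th.ord) {x : Ordinal.{u} → Ordinal.{u} → Ordinal.{u}}
    (hx : ∀ α < lam.ord, ∀ i < a, x α i < lam.ord)
    (hinj : ∀ α < lam.ord, ∀ i < a, ∀ i' < a, x α i = x α i' → i = i') :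
    ∃ w : (Set.Iio a × Set.Iio a → Set.Iio chi.ord) × (Set.Iio a → Set.Iio a × Set.Iio a → Prop),
      Function.Injective w.2 ∧ IsStat lam {α | α < lam.ord ∧
        ∀ i : Set.Iio a, w.2 i = fun p => w.1 p ∈ r (x α i)} := by
  have : Nonempty (Set.Iio chi.ord) :=
    ⟨⟨0, (Cardinal.isSuccLimit_ord hchi0).bot_lt⟩⟩
  have h1 : ∀ α < lam.ord, ∀ q : Set.Iio a × Set.Iio a, ∃ z : Set.Iio chi.ord,
      q.1 ≠ q.2 → ¬ (z ∈ r (x α q.1) ↔ z ∈ r (x α q.2)) := by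
    intro α hα q
    by_cases hq : q.1 = q.2
    · exact ⟨Classical.arbitrary _, fun h => absurd hq h⟩
    · by_contra! hcon
      refine hq (Subtype.ext (hinj α hα _ q.1.2 _ q.2.2 (hr _ (hx α hα _ q.1.2) _
        (hx α hα _ q.2.2) (Set.ext fun z => ?_))))
      have := (hcon z).2
      tauto
  choose! z hz using h1
  obtain ⟨w, hw⟩ := (isStat_univ hlam (hchi0.trans_lt hchilam)).exists_fiber hlam
    (ι := (Set.Iio a × Set.Iio a → Set.Iio chi.ord) × (Set.Iio a → Set.Iio a × Set.Iio a → Prop))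
    (by
      rw [Cardinal.lift_id'.{u, u + 1}]
      exact (mk_separators_le hth hchi0 hchi ha).trans_lt (Cardinal.lift_lt.2 hchilam))
    (fun α => (z α, fun i p => z α p ∈ r (x α i)))
  refine ⟨w, ?_, hw.mono fun α hα hα' => ⟨hα', fun i => ?_⟩⟩
  · obtain ⟨α, ⟨-, rfl⟩, hα, -⟩ := hw.exists_mem_gt hlam.1 hlam.ord_pos
    intro i i' hii
    by_contra hne
    exact hz α hα (i, i') hne (iff_of_eq (congrFun hii (i, i')))
  · rw [← hα.2]

/-- Stationarily many pairwise disjoint families include one that lies entirely above `ν`: only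
boundedly many of them have an element at or below `ν`. -/
theorem exists_family_above {lam : Cardinal.{u}} (hlam : lam.IsRegular) {B : Set Ordinal.{u}}
    (hB : IsStat lam B) {a : Ordinal.{u}} {x : Ordinal.{u} → Ordinal.{u} → Ordinal.{u}}
    (hinj : ∀ α < lam.ord, ∀ i < a, ∀ β < lam.ord, ∀ i' < a, x α i = x β i' → α = β ∧ i = i')
    {ν : Ordinal.{u}} (hν : ν < lam.ord) :
    ∃ α ∈ B, α < lam.ord ∧ ν < α ∧ ∀ i < a, ν < x α i := by
  have h1 : ∀ y, (∃ α < lam.ord, ∃ i < a, x α i = y) → ∃ α < lam.ord, ∃ i < a, x α i = y :=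
    fun _ h => h
  choose! f hf i hi hfi using h1
  obtain ⟨b, hb, hb'⟩ := exists_bound_set (δ := lam.ord)
    (s := {y | y < ν + 1 ∧ ∃ α < lam.ord, ∃ i < a, x α i = y}) (by
      rw [hlam.cof_ord]
      refine (Cardinal.mk_le_mk_of_subset (t := Set.Iio (ν + 1)) fun y hy => hy.1).trans_lt ?_
      rw [Cardinal.mk_Iio_ordinal, Cardinal.lift_lt]
      exact Cardinal.lt_ord.1 ((Cardinal.isSuccLimit_ord hlam.1).add_one_lt hν)) f
    (fun y hy => hf y hy.2)
  obtain ⟨α, hα, hα', hbα⟩ := hB.exists_mem_gt hlam.1 (max_lt hb hν)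
  refine ⟨α, hα, hα', (le_max_right _ _).trans_lt hbα, fun j hj => ?_⟩
  by_contra! hcon
  have hex : ∃ β < lam.ord, ∃ i < a, x β i = x α j := ⟨α, hα', j, hj, rfl⟩
  have h2 := hb' (x α j) ⟨Order.lt_add_one_iff.2 hcon, hex⟩
  rw [(hinj _ (hf _ hex) _ (hi _ hex) _ hα' _ hj (hfi _ hex)).1] at h2
  exact h2.not_ge ((le_max_left _ _).trans hbα.le)

/-- The colouring for a single family in place of two: every pattern `H` occurs between two of its
members. -/
theorem exists_colouring_families {lam del th chi sig : Cardinal.{u}}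
    (hlam : lam = Order.succ del) (hdel : del.IsRegular)
    (hth_del : Order.succ th < del) (hth : ℵ₀ ≤ th)
    (hchi : chi = chi ^< th) (hchi_lam : chi < lam) (hlam_chi : lam ≤ 2 ^ chi)
    (hchi_sig : chi ≤ sig) (hsig : sig = sig ^< th) (hsig_lam : sig ≤ lam) :
    ∃ c : Ordinal.{u} → Ordinal.{u} → Ordinal.{u}, (∀ x y, c x y < sig.ord) ∧
      ∀ (a : Ordinal.{u}) (x H : Ordinal.{u} → Ordinal.{u} → Ordinal.{u}), a < th.ord →
        (∀ α < lam.ord, ∀ i < a, x α i < lam.ord) →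
        (∀ α < lam.ord, ∀ i < a, ∀ β < lam.ord, ∀ i' < a, x α i = x β i' → α = β ∧ i = i') →
        (∀ i < a, ∀ i' < a, H i i' < sig.ord) →
        ∃ α0 α1, α0 < α1 ∧ α1 < lam.ord ∧
          ∀ i < a, ∀ i' < a, x α0 i < x α1 i' ∧ c (x α0 i) (x α1 i') = H i i' := by
  have hlamr : lam.IsRegular := hlam ▸ isRegular_succ hdel.1
  have hchi0 : ℵ₀ ≤ chi := by
    by_contra! h
    exact ((hlamr.1.trans hlam_chi).trans_lt
      (Cardinal.power_lt_aleph0 Cardinal.ofNat_lt_aleph0 h)).false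
  -- otherwise `2 ^ χ ≤ χ ^ χ ≤ χ ^< θ = χ`
  have hth_chi : th ≤ chi := by
    by_contra! h
    refine (Cardinal.cantor chi).not_ge (((Cardinal.power_le_power_right ?_).trans
      (Cardinal.le_powerlt chi h)).trans hchi.ge)
    exact (Cardinal.ofNat_lt_aleph0 (n := 2)).le.trans hchi0
  have hsig0 : sig ≠ 0 := (Cardinal.aleph0_pos.trans_le (hchi0.trans hchi_sig)).ne'
  obtain ⟨r, hr⟩ := exists_separating hlam_chi
  have h0 : (0 : Ordinal.{u}) < sig.ord := by
    rw [pos_iff_ne_zero]; simpa using hsig0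
  have hcode : Nonempty (Code th chi sig) :=
    ⟨⟨⟨0, (Cardinal.isSuccLimit_ord hth).bot_lt⟩,
      (fun _ => ⟨0, (Cardinal.isSuccLimit_ord hchi0).bot_lt⟩, fun _ _ => True),
      fun _ => ⟨0, h0⟩⟩⟩
  obtain ⟨c, hc⟩ := exists_colouring_small_sets hth hdel hth_del (K := Code th chi sig) (by
    rw [Cardinal.lift_id'.{u, u + 1}, ← hlam]
    exact (mk_code_le hth hth_chi hchi hchi_sig hsig).trans (Cardinal.lift_le.2 hsig_lam))
  rw [← hlam] at hc
  refine ⟨fun x y => decode r (c x y) x y, fun x y => decode_lt hsig0 _ _ _ _,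
    fun a x H ha hx hinj hH => ?_⟩
  obtain ⟨w, hw, hB⟩ := exists_stat_separated hth hchi0 hchi hlamr hchi_lam hr ha hx
    (fun α hα i hi i' hi' h => (hinj α hα i hi α hα i' hi' h).2)
  have h1 := fun ν (hν : ν < lam.ord) => exists_family_above hlamr hB hinj hν
  choose! s hsB hs hνs hνx using h1
  have hcard : ∀ ν, #(x (s ν) '' Set.Iio a) ≤ Cardinal.lift.{u + 1} th := fun ν => by
    refine Cardinal.mk_image_le.trans ?_
    rw [Cardinal.mk_Iio_ordinal, Cardinal.lift_le]
    exact (Cardinal.lt_ord.1 ha).le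
  have hmem : ∀ ν < lam.ord, ∀ y ∈ x (s ν) '' Set.Iio a, ν < y ∧ y < lam.ord := by
    rintro ν hν _ ⟨i, hi, rfl⟩
    exact ⟨hνx ν hν i hi, hx _ (hs ν hν) i hi⟩
  obtain ⟨ν, δ, hδ, hνδ, hsδ, h2⟩ := hc (fun ν => x (s ν) '' Set.Iio a)
    (fun ν => x (s ν) '' Set.Iio a) (fun ν _ => hcard ν) hmem (fun ν _ => hcard ν) hmem s hs
    ⟨⟨a, ha⟩, w, fun q => ⟨H q.1 q.2, hH _ q.1.2 _ q.2.2⟩⟩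
  refine ⟨s ν, s δ, hsδ.trans (hνs δ hδ), hs δ hδ, fun i hi i' hi' => ?_⟩
  obtain ⟨h3, h4⟩ := h2 _ ⟨i, hi, rfl⟩ _ ⟨i', hi', rfl⟩
  refine ⟨h3, ?_⟩
  dsimp only
  rw [h4]
  exact decode_eq (⟨⟨a, ha⟩, w, fun q => ⟨H q.1 q.2, hH _ q.1.2 _ q.2.2⟩⟩ : Code th chi sig) hw
    (i := ⟨i, hi⟩) (i' := ⟨i', hi'⟩) ((hsB ν (hνδ.trans hδ)).2 ⟨i, hi⟩) ((hsB δ hδ).2 ⟨i', hi'⟩)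

theorem mainTheorem7 (lam del th chi sig : Cardinal.{u})
    (hlam : lam = Order.succ del) (hdel : del.IsRegular)
    (hth_del : Order.succ th < del) (hth : ℵ₀ ≤ th)
    (hchi : chi = chi ^< th) (hchi_lam : chi < lam) (hlam_chi : lam ≤ 2 ^ chi)
    (hchi_sig : chi ≤ sig) (hsig : sig = sig ^< th) (hsig_lam : sig ≤ lam) :
    Pr0 lam lam sig th th := by
  obtain ⟨c, hc, hc'⟩ := exists_colouring_families hlam hdel hth_del hth hchi hchi_lam hlam_chi
    hchi_sig hsig hsig_lam
  refine ⟨fun z => c z.inf z.sup, fun x y _ _ => hc _ _,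
    fun i0 i1 ζ0 ζ1 h hi0 hi1 h0 h1 hj0 hj1 hdisj hh => ?_⟩
  have hpos : 0 < sig.ord := zero_le.trans_lt (hc 0 0)
  have hadd : i0 + i1 < th.ord := isPrincipal_add_ord hth hi0 hi1
  have hsub : ∀ i, i0 ≤ i → i < i0 + i1 → i - i0 < i1 := fun i hi hi' => by
    rwa [← add_lt_add_iff_left i0, Ordinal.add_sub_cancel_of_le hi]
  classical
  -- concatenate the two families; only the colours between the first and the second part matter
  obtain ⟨α0, α1, hα, hα1, hcol⟩ := hc' (i0 + i1)
    (fun α i => if i < i0 then ζ0 α i else ζ1 α (i - i0))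
    (fun i j => if h i (j - i0) < sig.ord then h i (j - i0) else 0) hadd
    (fun α hα i hi => by
      split_ifs with hlt
      · exact h0 α hα i hlt
      · exact h1 α hα _ (hsub i (not_lt.1 hlt) hi))
    (fun α hα i hi β hβ i' hi' heq => by
      split_ifs at heq with hlt hlt' hlt'
      · exact hj0 α hα i hlt β hβ i' hlt' heq
      · exact absurd heq (hdisj α hα i hlt β hβ _ (hsub i' (not_lt.1 hlt') hi'))
      · exact absurd heq.symm (hdisj β hβ i' hlt' α hα _ (hsub i (not_lt.1 hlt) hi))
      · obtain ⟨h2, h3⟩ := hj1 α hα _ (hsub i (not_lt.1 hlt) hi) β hβ _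
          (hsub i' (not_lt.1 hlt') hi') heq
        refine ⟨h2, ?_⟩
        rw [← Ordinal.add_sub_cancel_of_le (not_lt.1 hlt), h3,
          Ordinal.add_sub_cancel_of_le (not_lt.1 hlt')])
    (fun i _ j _ => by
      split_ifs with hlt
      · exact hlt
      · exact hpos)
  refine ⟨α0, α1, hα, hα1, fun i hi j hj => ?_⟩
  have hii : i < i0 + i1 := hi.trans_le le_self_add
  obtain ⟨h2, h3⟩ := hcol i hii (i0 + j) (by simpa using hj)
  have hnot : ¬ i0 + j < i0 := not_lt.2 le_self_add
  simp only [hi, if_true, hnot, if_false, Ordinal.add_sub_cancel, hh i hi j hj] at h2 h3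
  change c (ζ0 α0 i ⊓ ζ1 α1 j) (ζ0 α0 i ⊔ ζ1 α1 j) = h i j
  rw [inf_eq_left.2 h2.le, sup_eq_right.2 h2.le, h3]
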